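/- **Theorem 4.** *Model.* Let $a,c,p$ be fixed, let $\boldsymbol z_{ij}\in\mathbb R^c$ be fixed covariates and $\boldsymbol\epsilon_{ij}$ random vectors in $\mathbb R^p$ ($1\le i\le a$, $j\ge1$). Group $i$ has size $n_i$, $N=\sum_i n_i$, and $$\boldsymbol Y_{ij}=\boldsymbol\mu_i+\sum_{w=1}^c z_{ij}^{(w)}\boldsymbol\nu^{(w)}+\boldsymbol\epsilon_{ij},\qquad 1\le j\le n_i .$$ Let $X=(\bigoplus_i \mathbf 1_{n_i},Z)$ be the $N\times(a+c)$ design matrix, where the rows of $Z$ are the $\boldsymbol z_{ij}'$. Let $\boldsymbol\mu=(\boldsymbol\mu_1',\dots,\boldsymbol\mu_a')'$, $\boldsymbol\nu=(\boldsymbol\nu^{(1)\prime},\dots,\boldsymbol\nu^{(c)\prime})'$, $\boldsymbol\beta=(\boldsymbol\mu',\boldsymbol\nu')'$, let $\hat{\boldsymbol\beta}=(\hat{\boldsymbol\mu}',\hat{\boldsymbol\nu}')'$ be the ordinary least squares estimator and $\boldsymbol u_{ij}$ the $p$-dimensional residuals. Put $$\hat\Sigma_i=\frac1{n_i-c-1}\sum_{j=1}^{n_i}\boldsymbol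 u_{ij}\boldsymbol u_{ij}',\qquad \hat D=\operatorname{diag}\big(n_1^{-1}\hat\sigma_{11}^2,\dots,n_1^{-1}\hat\sigma_{1p}^2,\dots,n_a^{-1}\hat\sigma_{ap}^2\big),\quad \hat\sigma_{ik}^2=(\hat\Sigma_i)_{kk}.$$ For a contrast matrix $H$ with $ap$ columns ($H\mathbf 1_{ap}=\mathbf 0$; any number of rows, e.g. $(a-1)p$ rows and full row rank) let $T=H'(HH')^+H$, where $^+$ is the Moore–Penrose inverse, and let the MANCATS be $$A(T)=\hat{\boldsymbol\mu}'T'(T\hat DT)^+T\hat{\boldsymbol\mu}.$$ *Bootstrap.* Given the data $\boldsymbol Y$, draw independent $\boldsymbol Y^\star_{ij}\sim\mathcal N(\mathbf 0,\hat\Sigma_i)$, $1\le i\le a$, $1\le j\le n_i$, and let $A^\star(T)$ be the MANCATS computed, with the same design matrix, from the $\boldsymbol Y^\star_{ij}$. *Assumptions* (limits as $N\to\infty$). (M1) The $\boldsymbol\epsilon_{ij}$ are independent with mean $\mathbf 0$, covariance matrix $\Sigma_i$, and $E(\epsilon_{ijk}^4)\le C_1<\infty$ for all $i,j,k$. (M2)$^*$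 $\Sigma_i\ge0$ and $\sigma_{ik}^2:=(\Sigma_i)_{kk}>0$ for all $i,k$. (M3) $N/n_i\to\kappa_i\in(0,\infty)$ for all $i$. (M4) $X$ has full column rank for all large $N$, and so in the limit: $\Xi:=\lim N^{-1}X'X$, which exists by (M3), (M5) and (M6), is nonsingular. (M5) For all $i,w$: $\frac1n\sum_{j=1}^{n}z_{ij}^{(w)}\to c_i^{(w)}\in\mathbb R$ as $n\to\infty$. (M6) For all $i$: $\frac1n\sum_{j=1}^{n}\boldsymbol z_{ij}\boldsymbol z_{ij}'\to\Xi_i\in\mathbb R^{c\times c}$ as $n\to\infty$. Finally, the limiting null distribution is not degenerate: $T\Lambda_{11}T\ne0$, where $\Lambda_{11}$ is the block belonging to $\boldsymbol\mu$ of $\Lambda=(\Xi^{-1}\otimes I_p)\Psi(\Xi^{-1}\otimes I_p)$, the limit of the covariance matrix of $\sqrt N(\hat{\boldsymbol\beta}-\boldsymbol\beta)$, with $\Psi=\lim N^{-1}(X'\otimes I_p)\operatorname{Cov}(\boldsymbol\epsilon)(X\otimes I_p)$. *Conclusion.* For every $\boldsymbol\beta$ and every $\boldsymbol\beta_0=(\boldsymbol\mu_0',\boldsymbol\nu_0')'$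 in $\mathbb R^{(a+c)p}$ with $T\boldsymbol\mu_0=\mathbf 0$, if the data are generated under $\boldsymbol\beta$, then as $N\to\infty$ $$\sup_{x\in\mathbb R}\big|P_{\boldsymbol\beta}(A^\star(T)\le x\mid\boldsymbol Y)-P_{\boldsymbol\beta_0}(A(T)\le x)\big|\overset{P}{\longrightarrow}0 .$$ Consequently the parametric bootstrap MANCATS test is asymptotically valid: for every $\alpha\in(0,1)$ and every $\boldsymbol\beta_0$ with $T\boldsymbol\mu_0=\mathbf 0$, $P_{\boldsymbol\beta_0}\big(A(T)>q^\star_{1-\alpha}\big)\to\alpha$, where $q^\star_{1-\alpha}$ is the conditional $(1-\alpha)$-quantile of $A^\star(T)$ given $\boldsymbol Y$. -/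

import Mathlib

open Matrix MeasureTheory ProbabilityTheory Filter Topology
open scoped Kronecker

namespace Mancova

/-! ### Moore–Penrose inverse of a real matrix -/

/-- `B` is the Moore–Penrose inverse of `A`: the four Penrose equations. -/
structure IsMoorePenrose {m n : Type*} [Fintype m] [Fintype n]
    (A : Matrix m n ℝ) (B : Matrix n m ℝ) : Prop where
  mul_mul_left : A * B * A = A
  mul_mul_right : B * A * B = B
  symm_left : (A * B)ᵀ = A * B
  symm_right : (B * A)ᵀ = B * A

theorem IsMoorePenrose.unique {m n : Type*} [Fintype m] [Fintype n]
    {A : Matrix m n ℝ} {B C : Matrix n m ℝ}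
    (hB : IsMoorePenrose A B) (hC : IsMoorePenrose A C) : B = C := by
  have h1 : A * B = A * C := by
    have e1 : A * B = (A * C) * (A * B) := by
      rw [← Matrix.mul_assoc, hC.mul_mul_left]
    calc A * B = (A * B)ᵀ := hB.symm_left.symm
      _ = ((A * C) * (A * B))ᵀ := by rw [← e1]
      _ = (A * B) * (A * C) := by rw [transpose_mul, hB.symm_left, hC.symm_left]
      _ = A * C := by rw [← Matrix.mul_assoc, hB.mul_mul_left]
  have h2 : B * A = C * A := by
    have e1 : B * A = (B * A) * (C * A) := by
      rw [Matrix.mul_assoc, ← Matrix.mul_assoc A, hC.mul_mul_left]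
    calc B * A = (B * A)ᵀ := hB.symm_right.symm
      _ = ((B * A) * (C * A))ᵀ := by rw [← e1]
      _ = (C * A) * (B * A) := by rw [transpose_mul, hB.symm_right, hC.symm_right]
      _ = C * A := by rw [Matrix.mul_assoc, ← Matrix.mul_assoc A, hB.mul_mul_left]
  calc B = B * A * B := hB.mul_mul_right.symm
    _ = C * (A * B) := by rw [h2, Matrix.mul_assoc]
    _ = C * A * C := by rw [h1, Matrix.mul_assoc]
    _ = C := hC.mul_mul_right

theorem exists_isMoorePenrose {m n : Type*} [Fintype m] [Fintype n]
    (A : Matrix m n ℝ) : ∃ B, IsMoorePenrose A B := by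
  classical
  have hS : (Aᵀ * A).IsHermitian := by
    simpa using isHermitian_conjTranspose_mul_self A
  obtain ⟨R, hRt, h1, h2, h3⟩ : ∃ R : Matrix n n ℝ, Rᵀ = R ∧ (Aᵀ * A) * R * (Aᵀ * A) = Aᵀ * A ∧
      R * (Aᵀ * A) * R = R ∧ (Aᵀ * A) * R = R * (Aᵀ * A) := by
    obtain ⟨U, d, hU, hSd⟩ : ∃ (U : Matrix n n ℝ) (d : n → ℝ), Uᵀ * U = 1 ∧
        Aᵀ * A = U * diagonal d * Uᵀ := by
      refine ⟨hS.eigenvectorUnitary, hS.eigenvalues, ?_, ?_⟩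
      · simpa [star_eq_conjTranspose, conjTranspose_eq_transpose_of_trivial] using
          Unitary.coe_star_mul_self hS.eigenvectorUnitary
      · have := hS.spectral_theorem
        simpa [Unitary.conjStarAlgAut_apply, star_eq_conjTranspose, Function.comp_def] using this
    have key : ∀ x y : n → ℝ, (U * diagonal x * Uᵀ) * (U * diagonal y * Uᵀ) =
        U * diagonal (fun i => x i * y i) * Uᵀ := by
      intro x y
      rw [← diagonal_mul_diagonal]
      calc (U * diagonal x * Uᵀ) * (U * diagonal y * Uᵀ)
          = U * diagonal x * (Uᵀ * U) * diagonal y * Uᵀ := by simp only [Matrix.mul_assoc]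
        _ = _ := by rw [hU]; simp only [Matrix.mul_assoc, Matrix.mul_one]
    refine ⟨U * diagonal (fun i => (d i)⁻¹) * Uᵀ, ?_, ?_, ?_, ?_⟩
    · simp [transpose_mul, Matrix.mul_assoc]
    · rw [hSd, key, key]; simp
    · have hd : ∀ x : ℝ, x⁻¹ * x * x⁻¹ = x⁻¹ := fun x => by
        by_cases hx : x = 0 <;> simp [hx]
      rw [hSd, key, key]; simp only [hd]
    · rw [hSd, key, key]; simp [mul_comm]
  refine ⟨R * Aᵀ, ?_, ?_, ?_, ?_⟩
  · have h0 : Aᴴ * A * (R * (Aᵀ * A) - 1) = 0 := by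
      rw [conjTranspose_eq_transpose_of_trivial, Matrix.mul_sub, ← Matrix.mul_assoc, h1]; simp
    have := (conjTranspose_mul_self_mul_eq_zero A _).1 h0
    rw [Matrix.mul_sub, Matrix.mul_one, sub_eq_zero] at this
    simpa only [Matrix.mul_assoc] using this
  · calc R * Aᵀ * A * (R * Aᵀ) = (R * (Aᵀ * A) * R) * Aᵀ := by simp only [Matrix.mul_assoc]
      _ = R * Aᵀ := by rw [h2]
  · simp [transpose_mul, hRt, Matrix.mul_assoc]
  · rw [Matrix.mul_assoc, transpose_mul, hRt, transpose_mul, transpose_transpose, h3]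

/-- The Moore–Penrose inverse `A⁺`. -/
noncomputable def pinv {m n : Type*} [Fintype m] [Fintype n]
    (A : Matrix m n ℝ) : Matrix n m ℝ := (exists_isMoorePenrose A).choose

theorem pinv_spec {m n : Type*} [Fintype m] [Fintype n] (A : Matrix m n ℝ) :
    IsMoorePenrose A (pinv A) := (exists_isMoorePenrose A).choose_spec

/-! ### The linear model

`a` groups, `c` covariates, `p` outcomes; `n i` is the size of group `i`. Subject `j` of group `i`
is `⟨i, j⟩ : Subj n`, with fixed covariate vector `z i j`. Data are families
`Y : Subj n → Fin p → ℝ`, read as matrices with one row per subject. A coefficient matrix `B` has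
rows indexed by `Fin a ⊕ Fin c`: the rows `B (.inl i)` are the adjusted means `μ_i`, the rows
`B (.inr w)` the regression coefficients `ν^(w)`. -/

/-- The subjects of all groups. -/
abbrev Subj {a : ℕ} (n : Fin a → ℕ) : Type := Σ i : Fin a, Fin (n i)

/-- Total sample size `N = ∑ i, n i`. -/
def total {a : ℕ} (n : Fin a → ℕ) : ℕ := ∑ i, n i

/-- The design matrix `X = (⨁ 1_{n_i}, Z)`. -/
def design {a c : ℕ} (z : Fin a → ℕ → Fin c → ℝ) (n : Fin a → ℕ) :
    Matrix (Subj n) (Fin a ⊕ Fin c) ℝ :=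
  Matrix.of fun s => Sum.elim (Pi.single s.1 1) (z s.1 s.2)

/-- The ordinary least squares estimator `(X'X)⁻¹ X' Y` of the coefficient matrix. -/
noncomputable def ols {a c p : ℕ} (z : Fin a → ℕ → Fin c → ℝ) (n : Fin a → ℕ)
    (Y : Subj n → Fin p → ℝ) : Matrix (Fin a ⊕ Fin c) (Fin p) ℝ :=
  ((design z n)ᵀ * design z n)⁻¹ * (design z n)ᵀ * Matrix.of Y

/-- The stacked vector `(μ_1', …, μ_a')'` of adjusted means of a coefficient matrix. -/
def adjMeans {a c p : ℕ} (B : Matrix (Fin a ⊕ Fin c) (Fin p) ℝ) : Fin a × Fin p → ℝ :=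
  fun ik => B (Sum.inl ik.1) ik.2

/-- The residual vectors `u_ij`. -/
noncomputable def resid {a c p : ℕ} (z : Fin a → ℕ → Fin c → ℝ) (n : Fin a → ℕ)
    (Y : Subj n → Fin p → ℝ) : Subj n → Fin p → ℝ :=
  fun s k => Y s k - (design z n * ols z n Y) s k

/-- The groupwise residual covariance estimator
`Σ̂_i = (n_i - c - 1)⁻¹ ∑_j u_ij u_ij'`. -/
noncomputable def covEst {a c p : ℕ} (z : Fin a → ℕ → Fin c → ℝ) (n : Fin a → ℕ)
    (Y : Subj n → Fin p → ℝ) (i : Fin a) : Matrix (Fin p) (Fin p) ℝ :=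
  ((n i : ℝ) - c - 1)⁻¹ • ∑ j : Fin (n i), vecMulVec (resid z n Y ⟨i, j⟩) (resid z n Y ⟨i, j⟩)

/-- `D̂ = diag(n_1⁻¹ σ̂_11², …, n_a⁻¹ σ̂_ap²)`; the variance estimator `σ̂_ik²` is the `k`-th diagonal
entry of `Σ̂_i`. -/
noncomputable def diagEst {a c p : ℕ} (z : Fin a → ℕ → Fin c → ℝ) (n : Fin a → ℕ)
    (Y : Subj n → Fin p → ℝ) : Matrix (Fin a × Fin p) (Fin a × Fin p) ℝ :=
  diagonal fun ik => (n ik.1 : ℝ)⁻¹ * covEst z n Y ik.1 ik.2 ik.2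

/-- The projector form `T = H'(HH')⁺H` of a hypothesis matrix. -/
noncomputable def hypProj {a p r : ℕ} (H : Matrix (Fin r) (Fin a × Fin p) ℝ) :
    Matrix (Fin a × Fin p) (Fin a × Fin p) ℝ :=
  Hᵀ * pinv (H * Hᵀ) * H

/-- The MANCATS `A(T) = μ̂' T' (T D̂ T)⁺ T μ̂`. -/
noncomputable def mancats {a c p : ℕ} (z : Fin a → ℕ → Fin c → ℝ) (n : Fin a → ℕ)
    (T : Matrix (Fin a × Fin p) (Fin a × Fin p) ℝ) (Y : Subj n → Fin p → ℝ) : ℝ :=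
  adjMeans (ols z n Y) ⬝ᵥ
    ((Tᵀ * pinv (T * diagEst z n Y * T) * T) *ᵥ adjMeans (ols z n Y))

/-- The data of the MANCOVA model with coefficient matrix `B` and error vectors `e i j`. -/
def modelData {a c p : ℕ} (z : Fin a → ℕ → Fin c → ℝ) (n : Fin a → ℕ)
    (B : Matrix (Fin a ⊕ Fin c) (Fin p) ℝ) (e : Fin a → ℕ → Fin p → ℝ) :
    Subj n → Fin p → ℝ :=
  fun s k => (design z n * B) s k + e s.1 s.2 k

/-! ### The parametric bootstrap -/

/-- The conditional law, given the data `Y`, of the bootstrap sample: independent vectors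
`Y*_ij ∼ N(0, Σ̂_i)`. -/
noncomputable def bootMeasure {a c p : ℕ} (z : Fin a → ℕ → Fin c → ℝ) (n : Fin a → ℕ)
    (Y : Subj n → Fin p → ℝ) : Measure (Subj n → EuclideanSpace ℝ (Fin p)) :=
  Measure.pi fun s => multivariateGaussian 0 (covEst z n Y s.1)

/-- The conditional distribution function `x ↦ P(A*(T) ≤ x | Y)` of the bootstrap MANCATS. -/
noncomputable def bootCDF {a c p : ℕ} (z : Fin a → ℕ → Fin c → ℝ) (n : Fin a → ℕ)
    (T : Matrix (Fin a × Fin p) (Fin a × Fin p) ℝ) (Y : Subj n → Fin p → ℝ) (x : ℝ) : ℝ :=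
  (bootMeasure z n Y).real {y | mancats z n T (fun s k => y s k) ≤ x}

/-- The conditional `q`-quantile of the bootstrap MANCATS given the data. -/
noncomputable def bootQuantile {a c p : ℕ} (z : Fin a → ℕ → Fin c → ℝ) (n : Fin a → ℕ)
    (T : Matrix (Fin a × Fin p) (Fin a × Fin p) ℝ) (Y : Subj n → Fin p → ℝ) (q : ℝ) : ℝ :=
  sInf {x : ℝ | q ≤ bootCDF z n T Y x}

/-! ### Limits of the design and of the covariance of the least squares estimator -/

/-- The limit of `N⁻¹ X_i' X_i`, where `X_i` consists of the rows of `X` belonging to group `i`,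
when `N / n_i → κ_i` and the covariates of group `i` have limiting mean `m i` and limiting second
moment matrix `Ξ i`. -/
noncomputable def limGroupGram {a c : ℕ} (κ : Fin a → ℝ) (m : Fin a → Fin c → ℝ)
    (Ξ : Fin a → Matrix (Fin c) (Fin c) ℝ) (i : Fin a) :
    Matrix (Fin a ⊕ Fin c) (Fin a ⊕ Fin c) ℝ :=
  (κ i)⁻¹ • fromBlocks (vecMulVec (Pi.single i 1) (Pi.single i 1)) (vecMulVec (Pi.single i 1) (m i))
    (vecMulVec (m i) (Pi.single i 1)) (Ξ i)

/-- The limit of `N⁻¹ X' X`. -/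
noncomputable def limGram {a c : ℕ} (κ : Fin a → ℝ) (m : Fin a → Fin c → ℝ)
    (Ξ : Fin a → Matrix (Fin c) (Fin c) ℝ) : Matrix (Fin a ⊕ Fin c) (Fin a ⊕ Fin c) ℝ :=
  ∑ i, limGroupGram κ m Ξ i

/-- The limit `Λ = (Ξ⁻¹ ⊗ I_p) Ψ (Ξ⁻¹ ⊗ I_p)`, `Ψ = ∑ i, lim (N⁻¹ X_i' X_i) ⊗ Σ_i`, of the
covariance matrix of `√N (β̂ - β)`. -/
noncomputable def limCov {a c p : ℕ} (κ : Fin a → ℝ) (m : Fin a → Fin c → ℝ)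
    (Ξ : Fin a → Matrix (Fin c) (Fin c) ℝ) (S : Fin a → Matrix (Fin p) (Fin p) ℝ) :
    Matrix ((Fin a ⊕ Fin c) × Fin p) ((Fin a ⊕ Fin c) × Fin p) ℝ :=
  ((limGram κ m Ξ)⁻¹ ⊗ₖ (1 : Matrix (Fin p) (Fin p) ℝ)) *
    (∑ i, limGroupGram κ m Ξ i ⊗ₖ S i) *
    ((limGram κ m Ξ)⁻¹ ⊗ₖ (1 : Matrix (Fin p) (Fin p) ℝ))

/-- The block `Λ₁₁` of `Λ` belonging to the adjusted means. -/
noncomputable def limCovMeans {a c p : ℕ} (κ : Fin a → ℝ) (m : Fin a → Fin c → ℝ)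
    (Ξ : Fin a → Matrix (Fin c) (Fin c) ℝ) (S : Fin a → Matrix (Fin p) (Fin p) ℝ) :
    Matrix (Fin a × Fin p) (Fin a × Fin p) ℝ :=
  (limCov κ m Ξ S).submatrix (Prod.map Sum.inl id) (Prod.map Sum.inl id)

end Mancova

/-!
Under the null hypothesis the MANCATS is a function of the errors alone: `√N T (μ̂ - μ)` is a linear
image of the score `N^(-1/2) X' ε`, so `A(T)` is a quadratic form in the score
(`Mancova.mancats_eq`). Its matrix involves `(T N D̂ T)⁺` flanked by `T`. Since `T` is an
orthogonal projector and `N D̂` is positive definite with high probability, compression to the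
range of `T` turns this pseudoinverse into an ordinary inverse, which depends continuously on
`N D̂`; no rank can drop in the limit although the covariance matrices may be singular.

Hence three ingredients give the limit law of `A(T)`. The residual covariance estimators are
consistent, by the weak law of large numbers and the convergence of the design
(`Mancova.ErrorArray.tendsto_covEst`). The score is asymptotically normal with covariance matrix
`∑ i, lim (N⁻¹ X_i' X_i) ⊗ Σ_i`: the bound on fourth moments
reduces Lyapunov's condition to `N⁻² ∑ |z_ij|⁴ → 0`, a consequence of the convergence of the second
moments of the covariates (`Mancova.DesignLimit.sum_row_pow_four`).
Slutsky's argument combines both (`Mancova.ErrorArray.tendsto_measureReal_mancats_le`). The limit is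
the law of a quadratic form in a Gaussian vector which is not almost surely zero, precisely because
`T Λ₁₁ T ≠ 0`; such a law has no atoms (`Mancova.limit_quadratic_eq_null`), so by Pólya's argument
the convergence of distribution functions is uniform.

The same theorem yields the bootstrap limit. Everything is stated for arrays of independent errors
indexed along an arbitrary filter (`Mancova.ErrorArray`), and convergence in probability is
convergence along the filter `Mancova.whp` of events whose probability tends to one. Applied to
Gaussian errors along `atTop ×ˢ 𝓝 Σ`, the product of the sample size index with the covariance
matrices near the true ones (`Mancova.errorArray_bootstrap`), it says that the bootstrap distribution
function is uniformly close to the limit whenever the plugged-in covariance matrices are close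
to `Σ`, and by consistency they are with high probability. Finally, the conditional quantile lies with
high probability between two continuity points of the limit law at slightly shifted levels, which
gives the asymptotic level.
-/

namespace Mancova

/-! ### Convergence in probability as convergence along a filter -/

section Whp

variable {ι : Type*} {l : Filter ι} {Ω : ι → Type*} [∀ t, MeasurableSpace (Ω t)]
  {P : ∀ t, Measure (Ω t)}

/-- The filter of events that hold with probability tending to one along `l`, for a family of
probability spaces `Ω t`. A random quantity `X t ω` tends to `c` in probability iff
`fun s => X s.1 s.2` tends to `c` along this filter, so limits in probability obey the usual calculus
of limits. The events need not be measurable. -/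
def whp (l : Filter ι) (P : ∀ t, Measure (Ω t)) : Filter (Σ t, Ω t) where
  sets := {E | Tendsto (fun t => P t {ω | (⟨t, ω⟩ : Σ t, Ω t) ∉ E}) l (𝓝 0)}
  univ_sets := by simp [tendsto_const_nhds]
  sets_of_superset {E F} hE hEF :=
    tendsto_of_tendsto_of_tendsto_of_le_of_le tendsto_const_nhds hE (fun _ => zero_le)
      fun t => measure_mono fun ω hω h => hω (hEF h)
  inter_sets {E F} hE hF := by
    have h := Tendsto.add (show Tendsto _ _ _ from hE) (show Tendsto _ _ _ from hF)
    rw [add_zero] at h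
    refine tendsto_of_tendsto_of_tendsto_of_le_of_le tendsto_const_nhds h (fun _ => zero_le)
      fun t => (measure_mono fun ω hω => ?_).trans (measure_union_le _ _)
    by_cases h1 : (⟨t, ω⟩ : Σ t, Ω t) ∈ E
    · exact Or.inr fun h2 => hω ⟨h1, h2⟩
    · exact Or.inl h1

theorem eventually_whp {p : (Σ t, Ω t) → Prop} :
    (∀ᶠ s in whp l P, p s) ↔ Tendsto (fun t => P t {ω | ¬ p ⟨t, ω⟩}) l (𝓝 0) := Iff.rfl

theorem tendsto_fst_whp : Tendsto Sigma.fst (whp l P) l := by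
  intro E hE
  change Tendsto (fun t => P t {ω | ¬ t ∈ E}) l (𝓝 0)
  refine tendsto_const_nhds.congr' ?_
  filter_upwards [hE] with t ht
  simp [ht]

theorem eventually_measureReal_lt {p : (Σ t, Ω t) → Prop} (h : ∀ᶠ s in whp l P, p s)
    {η : ℝ} (hη : 0 < η) : ∀ᶠ t in l, (P t).real {ω | ¬ p ⟨t, ω⟩} < η := by
  have h1 := (ENNReal.tendsto_toReal ENNReal.zero_ne_top).comp (eventually_whp.1 h)
  exact h1.eventually_lt_const (by simpa using hη)

/-- Convergence in probability from small exceptional probabilities. -/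
theorem tendsto_whp_of_measure [∀ t, IsProbabilityMeasure (P t)] {X : (Σ t, Ω t) → ℝ} {c : ℝ}
    (h : ∀ η > 0, ∀ δ > 0, ∀ᶠ t in l, (P t).real {ω | η ≤ |X ⟨t, ω⟩ - c|} ≤ δ) :
    Tendsto X (whp l P) (𝓝 c) := by
  rw [Metric.tendsto_nhds]
  intro η hη
  rw [eventually_whp, ← ENNReal.tendsto_toReal_iff (fun _ => measure_ne_top _ _) (by simp)]
  rw [Metric.tendsto_nhds]
  intro δ hδ
  filter_upwards [h η hη (δ / 2) (half_pos hδ)] with t ht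
  simp only [not_lt, Real.dist_eq, ENNReal.toReal_zero, sub_zero]
  rw [abs_of_nonneg ENNReal.toReal_nonneg]
  exact lt_of_le_of_lt ht (half_lt_self hδ)

/-- **Weak law of large numbers** for triangular arrays of independent variables whose sums have
convergent means and vanishing variances. -/
theorem tendsto_sum_whp [∀ t, IsProbabilityMeasure (P t)] {J : ι → Type*} [∀ t, Fintype (J t)]
    {X : ∀ t, J t → Ω t → ℝ} (hX : ∀ t j, MemLp (X t j) 2 (P t))
    (hind : ∀ t, iIndepFun (X t) (P t)) {c : ℝ}
    (hmean : Tendsto (fun t => ∑ j, ∫ ω, X t j ω ∂P t) l (𝓝 c))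
    (hvar : Tendsto (fun t => ∑ j, ∫ ω, X t j ω ^ 2 ∂P t) l (𝓝 0)) :
    Tendsto (fun s : Σ t, Ω t => ∑ j, X s.1 j s.2) (whp l P) (𝓝 c) := by
  have hm : Tendsto (fun s : Σ t, Ω t => ∑ j, ∫ ω, X s.1 j ω ∂P s.1) (whp l P) (𝓝 c) :=
    hmean.comp tendsto_fst_whp
  have h0 : Tendsto (fun s : Σ t, Ω t => ∑ j, X s.1 j s.2 - ∑ j, ∫ ω, X s.1 j ω ∂P s.1)
      (whp l P) (𝓝 0) := by
    refine tendsto_whp_of_measure fun η hη δ hδ => ?_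
    have h1 : ∀ᶠ t in l, ∑ j, ∫ ω, X t j ω ^ 2 ∂P t < δ * η ^ 2 :=
      hvar.eventually_lt_const (by positivity)
    filter_upwards [h1] with t ht
    have hL : MemLp (fun ω => ∑ j, X t j ω) 2 (P t) := memLp_finsetSum _ fun j _ => hX t j
    have hc := meas_ge_le_variance_div_sq hL hη
    have hint : ∫ ω, ∑ j, X t j ω ∂P t = ∑ j, ∫ ω, X t j ω ∂P t :=
      integral_finsetSum _ fun j _ => (hX t j).integrable (by norm_num)
    have hv : Var[fun ω => ∑ j, X t j ω; P t] ≤ δ * η ^ 2 := by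
      have := IndepFun.variance_sum (s := Finset.univ) (X := X t) (fun j _ => hX t j)
        (fun i _ j _ hij => (hind t).indepFun hij)
      have e : (∑ i, X t i) = fun ω => ∑ j, X t j ω := by ext; simp
      rw [e] at this
      rw [this]
      refine le_trans (Finset.sum_le_sum fun j _ => ?_) ht.le
      exact variance_le_expectation_sq (hX t j).aestronglyMeasurable
    simp only [sub_zero]
    rw [hint] at hc
    refine ENNReal.toReal_le_of_le_ofReal hδ.le (hc.trans (ENNReal.ofReal_le_ofReal ?_))
    rw [div_le_iff₀ (by positivity)]
    exact hv
  simpa using h0.add hm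

/-- A factor that tends to zero in probability absorbs a variable with bounded second moments. -/
theorem tendsto_mul_sq_whp [∀ t, IsProbabilityMeasure (P t)] {Y V : (Σ t, Ω t) → ℝ}
    (hY : Tendsto Y (whp l P) (𝓝 0)) (hV : ∀ t, MemLp (fun ω => V ⟨t, ω⟩) 2 (P t)) {C : ℝ}
    (hC : ∀ᶠ t in l, ∫ ω, V ⟨t, ω⟩ ^ 2 ∂P t ≤ C) :
    Tendsto (fun s => Y s * V s ^ 2) (whp l P) (𝓝 0) := by
  refine tendsto_whp_of_measure fun η hη δ hδ => ?_
  set L : ℝ := 2 * (|C| + 1) / δ with hL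
  have hLpos : 0 < L := by positivity
  have h1 : ∀ᶠ s in whp l P, |Y s| < η / L := by
    have := hY.abs
    rw [abs_zero] at this
    exact this.eventually_lt_const (by positivity)
  filter_upwards [hC, eventually_measureReal_lt h1 (half_pos hδ)] with t htC ht
  have h2 : (P t).real {ω | L ≤ V ⟨t, ω⟩ ^ 2} ≤ δ / 2 := by
    have := mul_meas_ge_le_integral_of_nonneg (μ := P t) (f := fun ω => V ⟨t, ω⟩ ^ 2)
      (ae_of_all _ fun ω => sq_nonneg _) (hV t).integrable_sq L
    have h3 : L * (P t).real {ω | L ≤ V ⟨t, ω⟩ ^ 2} ≤ |C| + 1 :=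
      this.trans (htC.trans ((le_abs_self C).trans (by linarith)))
    calc (P t).real {ω | L ≤ V ⟨t, ω⟩ ^ 2} ≤ (|C| + 1) / L := by
          rw [le_div_iff₀ hLpos, mul_comm]; exact h3
      _ = δ / 2 := by rw [hL]; field_simp
  have hsub : {ω | η ≤ |Y ⟨t, ω⟩ * V ⟨t, ω⟩ ^ 2 - 0|} ⊆
      {ω | L ≤ V ⟨t, ω⟩ ^ 2} ∪ {ω | ¬ |Y ⟨t, ω⟩| < η / L} := by
    intro ω hω
    by_contra hcon
    simp only [Set.mem_union, Set.mem_ofPred_eq, not_or, not_le, not_not] at hcon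
    simp only [Set.mem_ofPred_eq, sub_zero, abs_mul, abs_of_nonneg (sq_nonneg (V ⟨t, ω⟩))] at hω
    have : |Y ⟨t, ω⟩| * V ⟨t, ω⟩ ^ 2 < η := by
      calc |Y ⟨t, ω⟩| * V ⟨t, ω⟩ ^ 2 ≤ |Y ⟨t, ω⟩| * L :=
            mul_le_mul_of_nonneg_left hcon.1.le (abs_nonneg _)
        _ < η / L * L := mul_lt_mul_of_pos_right hcon.2 hLpos
        _ = η := by field_simp
    linarith
  calc _ ≤ _ := measureReal_mono hsub
    _ ≤ _ := measureReal_union_le _ _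
    _ ≤ δ := by linarith

/-- **Slutsky's theorem** for quadratic forms: replacing a random matrix by its limit in
probability does not matter in a quadratic form of a vector with bounded second moments. -/
theorem tendsto_quadratic_sub_whp [∀ t, IsProbabilityMeasure (P t)] {β : Type*} [Fintype β]
    {M : (Σ t, Ω t) → Matrix β β ℝ} {M₀ : Matrix β β ℝ} (hM : Tendsto M (whp l P) (𝓝 M₀))
    {V : (Σ t, Ω t) → β → ℝ} (hV : ∀ b t, MemLp (fun ω => V ⟨t, ω⟩ b) 2 (P t)) {C : β → ℝ}
    (hC : ∀ b, ∀ᶠ t in l, ∫ ω, V ⟨t, ω⟩ b ^ 2 ∂P t ≤ C b) :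
    Tendsto (fun s => V s ⬝ᵥ (M s *ᵥ V s) - V s ⬝ᵥ (M₀ *ᵥ V s)) (whp l P) (𝓝 0) := by
  have h1 : ∀ x y, Tendsto (fun s => (M s x y - M₀ x y) * (V s x * V s y)) (whp l P) (𝓝 0) := by
    intro x y
    have hD : Tendsto (fun s => |M s x y - M₀ x y|) (whp l P) (𝓝 0) := by
      have := ((tendsto_pi_nhds.1 (tendsto_pi_nhds.1 hM x) y).sub_const (M₀ x y)).abs
      simpa using this
    have hb := (tendsto_mul_sq_whp (V := fun s => V s x) hD (hV x) (hC x)).add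
      (tendsto_mul_sq_whp (V := fun s => V s y) hD (hV y) (hC y))
    rw [add_zero] at hb
    refine squeeze_zero_norm (fun s => ?_) hb
    rw [Real.norm_eq_abs, abs_mul, ← mul_add]
    refine mul_le_mul_of_nonneg_left ?_ (abs_nonneg _)
    rw [abs_le]
    constructor <;> nlinarith [sq_nonneg (V s x + V s y), sq_nonneg (V s x - V s y),
      sq_nonneg (V s x), sq_nonneg (V s y)]
  have h2 : Tendsto (fun s => ∑ x, ∑ y, (M s x y - M₀ x y) * (V s x * V s y)) (whp l P) (𝓝 0) := by
    have := tendsto_finsetSum Finset.univ fun x _ => tendsto_finsetSum Finset.univ fun y _ => h1 x y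
    simpa using this
  refine h2.congr fun s => ?_
  simp only [dotProduct, mulVec, Finset.mul_sum, ← Finset.sum_sub_distrib]
  refine Finset.sum_congr rfl fun x _ => Finset.sum_congr rfl fun y _ => by ring

/-- If the distribution functions of `R` converge to a continuous `F` and `A - R` tends to zero
in probability, then so do the distribution functions of `A`. No measurability of `A` is assumed;
hence the upper tails, handled separately. -/
theorem tendsto_measureReal_le_of_sub [∀ t, IsProbabilityMeasure (P t)]
    {A R : (Σ t, Ω t) → ℝ} (hR : ∀ t, Measurable fun ω => R ⟨t, ω⟩) {F : ℝ → ℝ} (hF : Continuous F)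
    (hcdf : ∀ x, Tendsto (fun t => (P t).real {ω | R ⟨t, ω⟩ ≤ x}) l (𝓝 (F x)))
    (hAR : Tendsto (fun s => A s - R s) (whp l P) (𝓝 0)) (x : ℝ) :
    Tendsto (fun t => (P t).real {ω | A ⟨t, ω⟩ ≤ x}) l (𝓝 (F x)) ∧
      Tendsto (fun t => (P t).real {ω | x < A ⟨t, ω⟩}) l (𝓝 (1 - F x)) := by
  have hcompl : ∀ t y, (P t).real {ω | y < R ⟨t, ω⟩} = 1 - (P t).real {ω | R ⟨t, ω⟩ ≤ y} := by
    intro t y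
    rw [← probReal_compl_eq_one_sub (measurableSet_le (hR t) measurable_const)]
    congr 1
    ext ω
    simp
  have key : ∀ δ > 0, ∃ η > 0, |F (x + η) - F x| < δ ∧ |F (x - η) - F x| < δ := by
    intro δ hδ
    obtain ⟨η, hη, h⟩ := Metric.continuous_iff.1 hF x δ hδ
    refine ⟨η / 2, half_pos hη, ?_, ?_⟩
    · have := h (x + η / 2) (by
        rw [Real.dist_eq]; simp [abs_of_pos (half_pos hη), hη])
      rwa [Real.dist_eq] at this
    · have := h (x - η / 2) (by
        rw [Real.dist_eq]; simp [abs_of_pos (half_pos hη), hη])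
      rwa [Real.dist_eq] at this
  have main : ∀ δ > 0, ∀ᶠ t in l, |(P t).real {ω | A ⟨t, ω⟩ ≤ x} - F x| < δ ∧
      |(P t).real {ω | x < A ⟨t, ω⟩} - (1 - F x)| < δ := by
    intro δ hδ
    obtain ⟨η, hη, hF1, hF2⟩ := key (δ / 3) (by positivity)
    have hbad : ∀ᶠ s in whp l P, |A s - R s| < η := by
      have := hAR.abs
      rw [abs_zero] at this
      exact this.eventually_lt_const hη
    have c1 := Metric.tendsto_nhds.1 (hcdf (x + η)) (δ / 3) (by positivity)
    have c2 := Metric.tendsto_nhds.1 (hcdf (x - η)) (δ / 3) (by positivity)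
    filter_upwards [eventually_measureReal_lt hbad (show 0 < δ / 3 by positivity), c1, c2]
      with t hb h1 h2
    rw [Real.dist_eq] at h1 h2
    have i1 : (P t).real {ω | A ⟨t, ω⟩ ≤ x} ≤ (P t).real {ω | R ⟨t, ω⟩ ≤ x + η} +
        (P t).real {ω | ¬ |A ⟨t, ω⟩ - R ⟨t, ω⟩| < η} := by
      refine (measureReal_mono fun ω hω => ?_).trans (measureReal_union_le _ _)
      by_cases h : |A ⟨t, ω⟩ - R ⟨t, ω⟩| < η
      · left
        simp only [Set.mem_ofPred_eq] at hω ⊢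
        linarith [(abs_lt.1 h).1]
      · exact Or.inr h
    have i2 : (P t).real {ω | R ⟨t, ω⟩ ≤ x - η} ≤ (P t).real {ω | A ⟨t, ω⟩ ≤ x} +
        (P t).real {ω | ¬ |A ⟨t, ω⟩ - R ⟨t, ω⟩| < η} := by
      refine (measureReal_mono fun ω hω => ?_).trans (measureReal_union_le _ _)
      by_cases h : |A ⟨t, ω⟩ - R ⟨t, ω⟩| < η
      · left
        simp only [Set.mem_ofPred_eq] at hω ⊢
        linarith [(abs_lt.1 h).2]
      · exact Or.inr h
    have i3 : (P t).real {ω | x < A ⟨t, ω⟩} ≤ (P t).real {ω | x - η < R ⟨t, ω⟩} +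
        (P t).real {ω | ¬ |A ⟨t, ω⟩ - R ⟨t, ω⟩| < η} := by
      refine (measureReal_mono fun ω hω => ?_).trans (measureReal_union_le _ _)
      by_cases h : |A ⟨t, ω⟩ - R ⟨t, ω⟩| < η
      · left
        simp only [Set.mem_ofPred_eq] at hω ⊢
        linarith [(abs_lt.1 h).2]
      · exact Or.inr h
    have i4 : (P t).real {ω | x + η < R ⟨t, ω⟩} ≤ (P t).real {ω | x < A ⟨t, ω⟩} +
        (P t).real {ω | ¬ |A ⟨t, ω⟩ - R ⟨t, ω⟩| < η} := by
      refine (measureReal_mono fun ω hω => ?_).trans (measureReal_union_le _ _)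
      by_cases h : |A ⟨t, ω⟩ - R ⟨t, ω⟩| < η
      · left
        simp only [Set.mem_ofPred_eq] at hω ⊢
        linarith [(abs_lt.1 h).1]
      · exact Or.inr h
    rw [hcompl] at i3 i4
    rw [abs_lt] at h1 h2 hF1 hF2
    rw [abs_lt, abs_lt]
    refine ⟨⟨by linarith, by linarith⟩, ⟨by linarith, by linarith⟩⟩
  constructor
  · refine Metric.tendsto_nhds.2 fun δ hδ => ?_
    filter_upwards [main δ hδ] with t ht using ht.1
  · refine Metric.tendsto_nhds.2 fun δ hδ => ?_
    filter_upwards [main δ hδ] with t ht using ht.2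

end Whp

/-! ### Uniform convergence of distribution functions -/

/-- **Pólya's theorem**: monotone functions with values in `[0, 1]` that converge pointwise to a
continuous distribution function converge uniformly. -/
theorem eventually_forall_abs_sub_lt_of_monotone {ι : Type*} {l : Filter ι} {G : ι → ℝ → ℝ}
    (hmono : ∀ t, Monotone (G t)) (h0 : ∀ t x, 0 ≤ G t x) (h1 : ∀ t x, G t x ≤ 1)
    {F : ℝ → ℝ} (hF : Continuous F) (hFmono : Monotone F)
    (hbot : Tendsto F atBot (𝓝 0)) (htop : Tendsto F atTop (𝓝 1))
    (h : ∀ x, Tendsto (fun t => G t x) l (𝓝 (F x))) {δ : ℝ} (hδ : 0 < δ) :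
    ∀ᶠ t in l, ∀ x, |G t x - F x| < δ := by
  obtain ⟨x₀, hx₀⟩ := (hbot.eventually_lt_const (show (0:ℝ) < δ / 4 by positivity)).exists
  obtain ⟨x₁, hx₁⟩ := (htop.eventually_const_lt (show 1 - δ / 4 < (1:ℝ) by linarith)).exists
  have hF0 : ∀ x, 0 ≤ F x := fun x => hFmono.le_of_tendsto hbot x
  have hF1 : ∀ x, F x ≤ 1 := fun x => hFmono.ge_of_tendsto htop x
  have hcompact : ∀ᶠ t in l, ∀ x ∈ Set.Icc x₀ x₁, |G t x - F x| < δ := by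
    refine (isCompact_Icc (a := x₀) (b := x₁)).induction_on
      (p := fun s => ∀ᶠ t in l, ∀ x ∈ s, |G t x - F x| < δ) (by simp)
      (fun s u hsu hu => hu.mono fun t ht x hx => ht x (hsu hx))
      (fun s u hs hu => (hs.and hu).mono fun t ht x hx => hx.elim (ht.1 x) (ht.2 x))
      fun x _ => ?_
    obtain ⟨η, hη, hη'⟩ := Metric.continuous_iff.1 hF x (δ / 4) (by positivity)
    have ha := hη' (x - η / 2) (by rw [Real.dist_eq]; simp [abs_of_pos (half_pos hη), hη])
    have hb := hη' (x + η / 2) (by rw [Real.dist_eq]; simp [abs_of_pos (half_pos hη), hη])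
    refine ⟨Set.Ioo (x - η / 2) (x + η / 2), mem_nhdsWithin_of_mem_nhds
      (Ioo_mem_nhds (by linarith) (by linarith)), ?_⟩
    filter_upwards [Metric.tendsto_nhds.1 (h (x - η / 2)) (δ / 4) (by positivity),
      Metric.tendsto_nhds.1 (h (x + η / 2)) (δ / 4) (by positivity)] with t hta htb y hy
    rw [Real.dist_eq, abs_lt] at ha hb hta htb
    have m1 := hmono t hy.1.le
    have m2 := hmono t hy.2.le
    have m3 := hFmono hy.1.le
    have m4 := hFmono hy.2.le
    rw [abs_lt]
    constructor <;> linarith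
  filter_upwards [hcompact, Metric.tendsto_nhds.1 (h x₀) (δ / 4) (by positivity),
    Metric.tendsto_nhds.1 (h x₁) (δ / 4) (by positivity)] with t ht ha hb x
  rw [Real.dist_eq, abs_lt] at ha hb
  rcases le_total x x₀ with hx | hx
  · have m1 := hmono t hx
    have m2 := hFmono hx
    rw [abs_lt]
    constructor <;> linarith [h0 t x, hF0 x]
  rcases le_total x₁ x with hx' | hx'
  · have m1 := hmono t hx'
    have m2 := hFmono hx'
    rw [abs_lt]
    constructor <;> linarith [h1 t x, hF1 x]
  exact ht x ⟨hx, hx'⟩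

/-! ### A central limit theorem for triangular arrays -/

theorem norm_exp_mul_I_sub_taylor_le (x : ℝ) :
    ‖Complex.exp (x * Complex.I) - (1 + x * Complex.I - (x : ℂ) ^ 2 / 2)‖ ≤ 4 * |x| ^ 3 := by
  have e : ∀ y : ℂ, 1 + y * Complex.I - y ^ 2 / 2 =
      ∑ m ∈ Finset.range 3, (y * Complex.I) ^ m / m.factorial := by
    intro y
    simp [Finset.sum_range_succ, Nat.factorial, mul_pow]
    ring
  have hn : ‖(x : ℂ) * Complex.I‖ = |x| := by simp
  rcases le_total |x| 1 with h | h
  · rw [e]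
    refine (Complex.exp_bound (by rwa [hn]) (by norm_num)).trans ?_
    rw [hn, mul_comm]
    refine mul_le_mul_of_nonneg_right ?_ (by positivity)
    norm_num [Nat.factorial]
  · have h1 : ‖Complex.exp (x * Complex.I)‖ = 1 := Complex.norm_exp_ofReal_mul_I x
    have h2 : ‖(x : ℂ) ^ 2 / 2‖ = |x| ^ 2 / 2 := by simp
    have h3 : ‖(1 : ℂ) + x * Complex.I‖ ≤ 1 + |x| := by
      refine (norm_add_le _ _).trans ?_
      rw [hn]; simp
    calc _ ≤ ‖Complex.exp (x * Complex.I)‖ + (‖(1 : ℂ) + x * Complex.I‖ + ‖(x : ℂ) ^ 2 / 2‖) :=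
          (norm_sub_le _ _).trans (by gcongr; exact norm_sub_le _ _)
      _ ≤ 1 + ((1 + |x|) + |x| ^ 2 / 2) := by rw [h1, h2]; gcongr
      _ ≤ 4 * |x| ^ 3 := by nlinarith [sq_nonneg (|x| - 1), mul_self_nonneg |x|]

theorem abs_exp_neg_sub_le {y : ℝ} (hy : 0 ≤ y) : |Real.exp (-y) - (1 - y)| ≤ y ^ 2 := by
  have h1 := Real.add_one_le_exp (-y)
  have h2 := Real.add_one_le_exp y
  have h3 : Real.exp (-y) * Real.exp y = 1 := by rw [← Real.exp_add]; simp
  have h4 := Real.exp_pos (-y)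
  rw [abs_of_nonneg (by linarith)]
  have h5 : Real.exp (-y) * (1 + y) ≤ 1 := by nlinarith
  nlinarith [mul_nonneg hy hy, mul_nonneg hy (mul_nonneg hy hy)]

theorem norm_prod_sub_prod_le {J : Type*} (s : Finset J) {f g : J → ℂ}
    (hf : ∀ j, ‖f j‖ ≤ 1) (hg : ∀ j, ‖g j‖ ≤ 1) :
    ‖∏ j ∈ s, f j - ∏ j ∈ s, g j‖ ≤ ∑ j ∈ s, ‖f j - g j‖ := by
  classical
  induction s using Finset.induction_on with
  | empty => simp
  | insert a s ha ih =>
    rw [Finset.prod_insert ha, Finset.prod_insert ha, Finset.sum_insert ha]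
    have hp : ‖∏ j ∈ s, f j‖ ≤ 1 := by
      rw [norm_prod]
      exact Finset.prod_le_one (fun _ _ => norm_nonneg _) fun j _ => hf j
    calc ‖f a * ∏ j ∈ s, f j - g a * ∏ j ∈ s, g j‖
        = ‖(f a - g a) * ∏ j ∈ s, f j + g a * (∏ j ∈ s, f j - ∏ j ∈ s, g j)‖ := by ring_nf
      _ ≤ ‖f a - g a‖ * ‖∏ j ∈ s, f j‖ + ‖g a‖ * ‖∏ j ∈ s, f j - ∏ j ∈ s, g j‖ := by
          rw [← norm_mul, ← norm_mul]; exact norm_add_le _ _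
      _ ≤ ‖f a - g a‖ * 1 + 1 * ∑ j ∈ s, ‖f j - g j‖ := by
          gcongr
          exact hg a
      _ = _ := by ring

theorem abs_pow_le_one_add_pow_four (x : ℝ) {k : ℕ} (hk : k ≤ 4) : |x| ^ k ≤ 1 + x ^ 4 := by
  have e : x ^ 4 = |x| ^ 4 := by rw [Even.pow_abs (by decide)]
  rw [e]
  rcases le_total |x| 1 with h | h
  · have := pow_le_one₀ (n := k) (abs_nonneg x) h
    have : 0 ≤ |x| ^ 4 := by positivity
    linarith
  · have := pow_le_pow_right₀ h hk
    linarith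

theorem integrable_abs_pow_of_pow_four {Ω : Type*} [MeasurableSpace Ω] {P : Measure Ω}
    [IsProbabilityMeasure P] {ξ : Ω → ℝ} (hm : Measurable ξ)
    (h4 : Integrable (fun ω => ξ ω ^ 4) P) {k : ℕ} (hk : k ≤ 4) :
    Integrable (fun ω => |ξ ω| ^ k) P := by
  refine ((integrable_const (1 : ℝ)).add h4).mono' (by fun_prop) (ae_of_all _ fun ω => ?_)
  rw [Real.norm_of_nonneg (by positivity)]
  exact abs_pow_le_one_add_pow_four _ hk

theorem memLp_two_of_pow_four {Ω : Type*} [MeasurableSpace Ω] {P : Measure Ω}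
    [IsProbabilityMeasure P] {ξ : Ω → ℝ} (hm : Measurable ξ)
    (h4 : Integrable (fun ω => ξ ω ^ 4) P) : MemLp ξ 2 P := by
  rw [memLp_two_iff_integrable_sq hm.aestronglyMeasurable]
  simpa using integrable_abs_pow_of_pow_four hm h4 (k := 2) (by norm_num)

theorem integral_sq_sq_le_integral_pow_four {Ω : Type*} [MeasurableSpace Ω] {P : Measure Ω}
    [IsProbabilityMeasure P] {ξ : Ω → ℝ} (hm : Measurable ξ)
    (h4 : Integrable (fun ω => ξ ω ^ 4) P) : (∫ ω, ξ ω ^ 2 ∂P) ^ 2 ≤ ∫ ω, ξ ω ^ 4 ∂P := by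
  have h2 : MemLp (fun ω => ξ ω ^ 2) 2 P := by
    rw [memLp_two_iff_integrable_sq (by fun_prop)]
    simpa [← pow_mul] using h4
  have := variance_nonneg (fun ω => ξ ω ^ 2) P
  rw [variance_eq_sub h2] at this
  have e : ∫ ω, ((fun ω => ξ ω ^ 2) ^ 2) ω ∂P = ∫ ω, ξ ω ^ 4 ∂P := by
    congr 1; ext ω; simp [← pow_mul]
  rw [e] at this
  linarith

/-- Third-order comparison of the characteristic function of a centred variable with that of the
Gaussian of the same variance. The third moment is traded for the second and fourth at the
price of a free parameter `δ`. -/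
theorem norm_integral_exp_sub_le {Ω : Type*} [MeasurableSpace Ω] {P : Measure Ω}
    [IsProbabilityMeasure P] {ξ : Ω → ℝ} (hm : Measurable ξ)
    (h4 : Integrable (fun ω => ξ ω ^ 4) P) (h0 : ∫ ω, ξ ω ∂P = 0) {δ : ℝ} (hδ : 0 < δ) :
    ‖∫ ω, Complex.exp (ξ ω * Complex.I) ∂P - Complex.exp (-((∫ ω, ξ ω ^ 2 ∂P : ℝ) : ℂ) / 2)‖ ≤
      2 * δ * ∫ ω, ξ ω ^ 2 ∂P + (2 / δ + 1) * ∫ ω, ξ ω ^ 4 ∂P := by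
  set v := ∫ ω, ξ ω ^ 2 ∂P with hv
  have hv0 : 0 ≤ v := integral_nonneg fun ω => sq_nonneg _
  have i1 : Integrable ξ P := (memLp_two_of_pow_four hm h4).integrable (by norm_num)
  have i2 : Integrable (fun ω => ξ ω ^ 2) P := (memLp_two_of_pow_four hm h4).integrable_sq
  have i3 := integrable_abs_pow_of_pow_four hm h4 (k := 3) (by norm_num)
  have ie : Integrable (fun ω => Complex.exp (ξ ω * Complex.I)) P := by
    refine Integrable.of_bound (by fun_prop) 1 (ae_of_all _ fun ω => ?_)
    rw [Complex.norm_exp_ofReal_mul_I]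
  have ic1 : Integrable (fun ω => (ξ ω : ℂ)) P := i1.ofReal
  have ic2 : Integrable (fun ω => ((ξ ω : ℂ)) ^ 2) P := by
    have := i2.ofReal (𝕜 := ℂ)
    simpa using this
  have it : Integrable (fun ω => 1 + ξ ω * Complex.I - (ξ ω : ℂ) ^ 2 / 2) P :=
    ((integrable_const _).add (ic1.mul_const _)).sub (ic2.div_const _)
  have et : ∫ ω, (1 + ξ ω * Complex.I - (ξ ω : ℂ) ^ 2 / 2) ∂P = ((1 - v / 2 : ℝ) : ℂ) := by
    have hi : Integrable (fun ω => 1 + ξ ω * Complex.I) P :=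
      (integrable_const _).add (ic1.mul_const _)
    rw [integral_sub hi (ic2.div_const _), integral_add (integrable_const _) (ic1.mul_const _), integral_mul_const, integral_div,
      integral_complex_ofReal, h0]
    have : ∫ ω, (ξ ω : ℂ) ^ 2 ∂P = (v : ℂ) := by
      rw [hv, ← integral_complex_ofReal]
      simp
    rw [this]
    simp
  have a1 : ‖∫ ω, Complex.exp (ξ ω * Complex.I) ∂P - ((1 - v / 2 : ℝ) : ℂ)‖ ≤
      ∫ ω, 4 * |ξ ω| ^ 3 ∂P := by
    rw [← et, ← integral_sub ie it]
    refine norm_integral_le_of_norm_le (i3.const_mul 4) (ae_of_all _ fun ω => ?_)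
    exact norm_exp_mul_I_sub_taylor_le _
  have a2 : ∫ ω, 4 * |ξ ω| ^ 3 ∂P ≤ 2 * δ * v + 2 / δ * ∫ ω, ξ ω ^ 4 ∂P := by
    rw [hv, ← integral_const_mul, ← integral_const_mul,
      ← integral_add (i2.const_mul _) (h4.const_mul _)]
    refine integral_mono (i3.const_mul 4) ((i2.const_mul _).add (h4.const_mul _)) fun ω => ?_
    have e4 : ξ ω ^ 4 = |ξ ω| ^ 4 := by rw [Even.pow_abs (by decide)]
    have e2 : ξ ω ^ 2 = |ξ ω| ^ 2 := by simp
    simp only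
    rw [e4, e2]
    have : 0 ≤ 2 / δ * (|ξ ω| ^ 2 * (δ - |ξ ω|) ^ 2) := by positivity
    have e5 : 2 / δ * (|ξ ω| ^ 2 * (δ - |ξ ω|) ^ 2) =
        2 * δ * |ξ ω| ^ 2 + 2 / δ * |ξ ω| ^ 4 - 4 * |ξ ω| ^ 3 := by
      field_simp
      ring
    linarith
  have a3 : ‖((1 - v / 2 : ℝ) : ℂ) - Complex.exp (-((v : ℝ) : ℂ) / 2)‖ ≤ ∫ ω, ξ ω ^ 4 ∂P := by
    have e : Complex.exp (-((v : ℝ) : ℂ) / 2) = ((Real.exp (-(v / 2)) : ℝ) : ℂ) := by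
      push_cast; congr 1; ring
    rw [e, ← Complex.ofReal_sub, Complex.norm_real, Real.norm_eq_abs, abs_sub_comm]
    have h1 := abs_exp_neg_sub_le (show 0 ≤ v / 2 by positivity)
    have h2 := integral_sq_sq_le_integral_pow_four hm h4
    rw [← hv] at h2
    nlinarith
  calc _ ≤ _ := norm_sub_le_norm_sub_add_norm_sub _ ((1 - v / 2 : ℝ) : ℂ) _
    _ ≤ _ := by linarith

section CLT

variable {ι : Type*} {l : Filter ι} {Ω : ι → Type*} [∀ t, MeasurableSpace (Ω t)]
  {P : ∀ t, Measure (Ω t)} [∀ t, IsProbabilityMeasure (P t)]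

/-- **Lyapunov's central limit theorem** (with fourth moments) on the level of characteristic
functions, for triangular arrays whose rows may live on different probability spaces. -/
theorem tendsto_integral_exp_sum {J : ι → Type*} [∀ t, Fintype (J t)]
    {ξ : ∀ t, J t → Ω t → ℝ} (hm : ∀ t j, Measurable (ξ t j))
    (hind : ∀ t, iIndepFun (ξ t) (P t)) (h4 : ∀ t j, Integrable (fun ω => ξ t j ω ^ 4) (P t))
    (h0 : ∀ t j, ∫ ω, ξ t j ω ∂P t = 0) {v : ℝ}
    (hv : Tendsto (fun t => ∑ j, ∫ ω, ξ t j ω ^ 2 ∂P t) l (𝓝 v))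
    (hL : Tendsto (fun t => ∑ j, ∫ ω, ξ t j ω ^ 4 ∂P t) l (𝓝 0)) :
    Tendsto (fun t => ∫ ω, Complex.exp ((∑ j, ξ t j ω : ℝ) * Complex.I) ∂P t) l
      (𝓝 (Complex.exp (-(v : ℂ) / 2))) := by
  have hprod : ∀ t, ∫ ω, Complex.exp ((∑ j, ξ t j ω : ℝ) * Complex.I) ∂P t =
      ∏ j, ∫ ω, Complex.exp (ξ t j ω * Complex.I) ∂P t := by
    intro t
    rw [← (hind t).integral_fun_prod_comp (X := ξ t) (f := fun _ x => Complex.exp ((x : ℂ) * Complex.I))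
      (fun j => (hm t j).aemeasurable) (fun j => by fun_prop)]
    congr 1
    ext ω
    rw [← Complex.exp_sum]
    push_cast
    rw [Finset.sum_mul]
  have hg : Tendsto (fun t => ∏ j, Complex.exp (-((∫ ω, ξ t j ω ^ 2 ∂P t : ℝ) : ℂ) / 2)) l
      (𝓝 (Complex.exp (-(v : ℂ) / 2))) := by
    have : ∀ t, ∏ j, Complex.exp (-((∫ ω, ξ t j ω ^ 2 ∂P t : ℝ) : ℂ) / 2) =
        Complex.exp (-((∑ j, ∫ ω, ξ t j ω ^ 2 ∂P t : ℝ) : ℂ) / 2) := by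
      intro t
      rw [← Complex.exp_sum]
      congr 1
      push_cast
      rw [← Finset.sum_div, Finset.sum_neg_distrib]
    simp_rw [this]
    have hc : Continuous fun x : ℝ => Complex.exp (-(x : ℂ) / 2) := by fun_prop
    exact (hc.tendsto v).comp hv
  have hdiff : Tendsto (fun t => ∏ j, ∫ ω, Complex.exp (ξ t j ω * Complex.I) ∂P t -
      ∏ j, Complex.exp (-((∫ ω, ξ t j ω ^ 2 ∂P t : ℝ) : ℂ) / 2)) l (𝓝 0) := by
    have hbound : ∀ t, ∀ δ > 0, ‖∏ j, ∫ ω, Complex.exp (ξ t j ω * Complex.I) ∂P t -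
        ∏ j, Complex.exp (-((∫ ω, ξ t j ω ^ 2 ∂P t : ℝ) : ℂ) / 2)‖ ≤
        2 * δ * ∑ j, ∫ ω, ξ t j ω ^ 2 ∂P t + (2 / δ + 1) * ∑ j, ∫ ω, ξ t j ω ^ 4 ∂P t := by
      intro t δ hδ
      refine (norm_prod_sub_prod_le _ (fun j => ?_) fun j => ?_).trans ?_
      · refine (norm_integral_le_integral_norm _).trans ?_
        simp [Complex.norm_exp_ofReal_mul_I]
      · rw [Complex.norm_exp]
        have : 0 ≤ ∫ ω, ξ t j ω ^ 2 ∂P t := integral_nonneg fun ω => sq_nonneg _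
        have e : (-((∫ ω, ξ t j ω ^ 2 ∂P t : ℝ) : ℂ) / 2).re = -(∫ ω, ξ t j ω ^ 2 ∂P t) / 2 := by
          rw [← Complex.ofReal_neg, show (2 : ℂ) = ((2 : ℝ) : ℂ) by norm_num, ← Complex.ofReal_div,
            Complex.ofReal_re]
        rw [e]
        exact Real.exp_le_one_iff.2 (by linarith)
      · rw [Finset.mul_sum, Finset.mul_sum, ← Finset.sum_add_distrib]
        exact Finset.sum_le_sum fun j _ =>
          norm_integral_exp_sub_le (hm t j) (h4 t j) (h0 t j) hδ
    rw [Metric.tendsto_nhds]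
    intro η hη
    set δ : ℝ := η / (4 * (|v| + 1)) with hδ
    have hδ0 : 0 < δ := by positivity
    have hlim : Tendsto (fun t => 2 * δ * ∑ j, ∫ ω, ξ t j ω ^ 2 ∂P t +
        (2 / δ + 1) * ∑ j, ∫ ω, ξ t j ω ^ 4 ∂P t) l (𝓝 (2 * δ * v + (2 / δ + 1) * 0)) :=
      (hv.const_mul _).add (hL.const_mul _)
    have hlt : 2 * δ * v + (2 / δ + 1) * 0 < η := by
      have h1 : 2 * δ * v ≤ 2 * δ * (|v| + 1) := by
        gcongr
        linarith [le_abs_self v]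
      have h2 : 2 * δ * (|v| + 1) = η / 2 := by rw [hδ]; field_simp; ring
      linarith
    filter_upwards [hlim.eventually_lt_const hlt] with t ht
    rw [dist_zero_right]
    exact (hbound t δ hδ0).trans_lt ht
  have := hdiff.add hg
  rw [zero_add] at this
  refine this.congr fun t => ?_
  rw [hprod]
  ring

/-- If characteristic functions converge pointwise to that of `μ₀`, the distribution functions of a
continuous function `q` with atomless law under `μ₀` converge. -/
theorem tendsto_measureReal_le_of_charFun [l.IsCountablyGenerated] {E : Type*}
    [NormedAddCommGroup E] [InnerProductSpace ℝ E] [FiniteDimensional ℝ E] [MeasurableSpace E]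
    [BorelSpace E] {V : ∀ t, Ω t → E} (hV : ∀ t, Measurable (V t)) {μ₀ : Measure E}
    [IsProbabilityMeasure μ₀]
    (hchar : ∀ θ, Tendsto (fun t => charFun ((P t).map (V t)) θ) l (𝓝 (charFun μ₀ θ)))
    {q : E → ℝ} (hq : Continuous q) {x : ℝ} (hx : μ₀ {v | q v = x} = 0) :
    Tendsto (fun t => (P t).real {ω | q (V t ω) ≤ x}) l (𝓝 (μ₀.real {v | q v ≤ x})) := by
  have hP : ∀ t, IsProbabilityMeasure ((P t).map (V t)) := fun t =>
    Measure.isProbabilityMeasure_map (hV t).aemeasurable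
  set M : ι → ProbabilityMeasure E := fun t => ⟨(P t).map (V t), hP t⟩
  have hM : Tendsto M l (𝓝 ⟨μ₀, inferInstance⟩) := by
    refine tendsto_of_seq_tendsto fun u hu => ?_
    exact ProbabilityMeasure.tendsto_of_tendsto_charFun fun θ => (hchar θ).comp hu
  have hfr : μ₀ (frontier {v | q v ≤ x}) = 0 :=
    measure_mono_null (frontier_le_subset_eq hq continuous_const) hx
  have := ProbabilityMeasure.tendsto_measure_of_null_frontier_of_tendsto' hM hfr
  have := (ENNReal.tendsto_toReal (measure_ne_top μ₀ _)).comp this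
  refine this.congr fun t => ?_
  simp only [Function.comp, M, ProbabilityMeasure.coe_mk]
  rw [Measure.map_apply (hV t) (measurableSet_le hq.measurable measurable_const)]
  rfl

end CLT

/-! ### Moore–Penrose inverses and the hypothesis projector -/

theorem tendsto_matrix_inv {X γ : Type*} [Fintype γ] [DecidableEq γ] {f : Filter X}
    {A : X → Matrix γ γ ℝ} {A₀ : Matrix γ γ ℝ} (h : Tendsto A f (𝓝 A₀)) (h0 : A₀.det ≠ 0) :
    Tendsto (fun x => (A x)⁻¹) f (𝓝 A₀⁻¹) := by
  simp only [Matrix.inv_def, Ring.inverse_eq_inv']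
  have hdet : Tendsto (fun x => (A x).det) f (𝓝 A₀.det) :=
    ((continuous_id.matrix_det).tendsto A₀).comp h
  have hadj : Tendsto (fun x => (A x).adjugate) f (𝓝 A₀.adjugate) :=
    ((continuous_id.matrix_adjugate).tendsto A₀).comp h
  exact (hdet.inv₀ h0).smul hadj

theorem pinv_eq {m n : Type*} [Fintype m] [Fintype n] {A : Matrix m n ℝ} {B : Matrix n m ℝ}
    (h : IsMoorePenrose A B) : pinv A = B :=
  (pinv_spec A).unique h

theorem pinv_smul {m n : Type*} [Fintype m] [Fintype n] (A : Matrix m n ℝ) {c : ℝ} (hc : c ≠ 0) :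
    pinv (c • A) = c⁻¹ • pinv A := by
  have h := pinv_spec A
  refine pinv_eq ⟨?_, ?_, ?_, ?_⟩
  · simp [smul_smul, hc, h.mul_mul_left]
  · simp [smul_smul, hc, h.mul_mul_right]
  · simp [smul_smul, hc, h.symm_left]
  · simp [smul_smul, hc, h.symm_right]

theorem pinv_transpose {m n : Type*} [Fintype m] [Fintype n] (A : Matrix m n ℝ) :
    pinv Aᵀ = (pinv A)ᵀ := by
  have h := pinv_spec A
  refine pinv_eq ⟨?_, ?_, ?_, ?_⟩
  · rw [← transpose_mul, ← transpose_mul, ← Matrix.mul_assoc, h.mul_mul_left]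
  · rw [← transpose_mul, ← transpose_mul, ← Matrix.mul_assoc, h.mul_mul_right]
  · rw [← transpose_mul, transpose_transpose, h.symm_right]
  · rw [← transpose_mul, transpose_transpose, h.symm_left]

theorem hypProj_transpose {a p r : ℕ} (H : Matrix (Fin r) (Fin a × Fin p) ℝ) :
    (hypProj H)ᵀ = hypProj H := by
  have : (pinv (H * Hᵀ))ᵀ = pinv (H * Hᵀ) := by
    rw [← pinv_transpose]; simp
  simp only [hypProj, transpose_mul, transpose_transpose, this, Matrix.mul_assoc]

theorem hypProj_mul_self {a p r : ℕ} (H : Matrix (Fin r) (Fin a × Fin p) ℝ) :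
    hypProj H * hypProj H = hypProj H := by
  have h := (pinv_spec (H * Hᵀ)).mul_mul_right
  calc hypProj H * hypProj H = Hᵀ * (pinv (H * Hᵀ) * (H * Hᵀ) * pinv (H * Hᵀ)) * H := by
        simp only [hypProj, Matrix.mul_assoc]
    _ = hypProj H := by rw [h]; rfl

section Projector

variable {γ : Type*} [Fintype γ] [DecidableEq γ]

/-- The compression `T D T` of `D` to the range of a projector `T`, completed by the identity on the
kernel. For positive `D` it is invertible, and depends continuously on `D`. -/
def compression (T D : Matrix γ γ ℝ) : Matrix γ γ ℝ := T * D * T + (1 - T)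

theorem compression_posDef {T : Matrix γ γ ℝ} (hT : Tᵀ = T) (hTT : T * T = T) {d : γ → ℝ}
    (hd : ∀ i, 0 < d i) : (compression T (diagonal d)).PosDef := by
  have hD : (diagonal d).PosDef := by
    rw [posDef_diagonal_iff]; exact hd
  have hC : (1 - T) = (1 - T)ᵀ * (1 - T) := by
    rw [transpose_sub, hT, transpose_one]; simp [Matrix.sub_mul, Matrix.mul_sub, hTT]
  have hTDT : T * diagonal d * T = Tᵀ * diagonal d * T := by rw [hT]
  refine PosDef.of_dotProduct_mulVec_pos ?_ fun x hx => ?_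
  · rw [IsHermitian, conjTranspose_eq_transpose_of_trivial, compression]
    simp [transpose_mul, hT, Matrix.mul_assoc]
  · have e : star x ⬝ᵥ (compression T (diagonal d) *ᵥ x) =
        (T *ᵥ x) ⬝ᵥ (diagonal d *ᵥ (T *ᵥ x)) + ((1 - T) *ᵥ x) ⬝ᵥ ((1 - T) *ᵥ x) := by
      rw [compression, hTDT]
      conv_lhs => rw [hC]
      simp only [star_trivial, add_mulVec, dotProduct_add, ← mulVec_mulVec]
      rw [dotProduct_mulVec x Tᵀ, vecMul_transpose, dotProduct_mulVec x (1 - T)ᵀ, vecMul_transpose]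
    rw [e]
    have h2 : 0 ≤ ((1 - T) *ᵥ x) ⬝ᵥ ((1 - T) *ᵥ x) := by
      simpa using dotProduct_star_self_nonneg ((1 - T) *ᵥ x)
    by_cases hx1 : T *ᵥ x = 0
    · have : (1 - T) *ᵥ x = x := by rw [sub_mulVec, hx1]; simp
      rw [hx1, this]
      simpa using dotProduct_star_self_pos_iff.2 hx
    · have := hD.dotProduct_mulVec_pos hx1
      rw [star_trivial] at this
      linarith

/-- The Moore–Penrose inverse of `T D T`, flanked by `T`, expressed by a genuine inverse. -/
theorem mul_pinv_mul_eq {T : Matrix γ γ ℝ} (hT : Tᵀ = T) (hTT : T * T = T) {d : γ → ℝ}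
    (hd : ∀ i, 0 < d i) :
    Tᵀ * pinv (T * diagonal d * T) * T = T * (compression T (diagonal d))⁻¹ * T := by
  set K := compression T (diagonal d) with hK
  have hu : IsUnit K.det := (compression_posDef hT hTT hd).det_pos.ne'.isUnit
  have hKt : Kᵀ = K := by
    rw [hK, compression]; simp [transpose_mul, hT, Matrix.mul_assoc]
  have c1 : T * K = T * diagonal d * T := by
    rw [hK, compression, Matrix.mul_add, Matrix.mul_sub, hTT, ← Matrix.mul_assoc, ← Matrix.mul_assoc,
      hTT]; simp
  have c2 : K * T = T * diagonal d * T := by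
    rw [hK, compression, Matrix.add_mul, Matrix.sub_mul, hTT, Matrix.mul_assoc, hTT]; simp
  have c3 : K⁻¹ * T = T * K⁻¹ := by
    calc K⁻¹ * T = K⁻¹ * (T * K) * K⁻¹ := by
          rw [Matrix.mul_assoc, Matrix.mul_assoc, mul_nonsing_inv _ hu, Matrix.mul_one]
      _ = K⁻¹ * (K * T) * K⁻¹ := by rw [c1, c2]
      _ = T * K⁻¹ := by rw [← Matrix.mul_assoc, nonsing_inv_mul _ hu, Matrix.one_mul]
  have p1 : T * diagonal d * T * (K⁻¹ * T) = T := by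
    rw [← c1, Matrix.mul_assoc, ← Matrix.mul_assoc K, mul_nonsing_inv _ hu, Matrix.one_mul, hTT]
  have p2 : K⁻¹ * T * (T * diagonal d * T) = T := by
    rw [← c2, c3, Matrix.mul_assoc, ← Matrix.mul_assoc K⁻¹, nonsing_inv_mul _ hu, Matrix.one_mul,
      hTT]
  have hp : pinv (T * diagonal d * T) = K⁻¹ * T := by
    refine pinv_eq ⟨?_, ?_, ?_, ?_⟩
    · rw [p1, ← Matrix.mul_assoc, ← Matrix.mul_assoc, hTT]
    · rw [p2, c3, ← Matrix.mul_assoc, hTT]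
    · rw [p1, hT]
    · rw [p2, hT]
  rw [hp, hT, ← Matrix.mul_assoc, Matrix.mul_assoc _ T T, hTT]

theorem dotProduct_compression_inv_pos {T : Matrix γ γ ℝ} (hT : Tᵀ = T) (hTT : T * T = T)
    {d : γ → ℝ} (hd : ∀ i, 0 < d i) {y : γ → ℝ} (hy : T *ᵥ y ≠ 0) :
    0 < y ⬝ᵥ ((T * (compression T (diagonal d))⁻¹ * T) *ᵥ y) := by
  have h := (compression_posDef hT hTT hd).inv.dotProduct_mulVec_pos hy
  rw [star_trivial] at h
  rw [← mulVec_mulVec, ← mulVec_mulVec, dotProduct_mulVec, ← hT, vecMul_transpose, hT]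
  exact h

theorem tendsto_compression_inv {X : Type*} {f : Filter X} {T : Matrix γ γ ℝ} (hT : Tᵀ = T)
    (hTT : T * T = T) {D : X → Matrix γ γ ℝ} {d : γ → ℝ} (hd : ∀ i, 0 < d i)
    (h : Tendsto D f (𝓝 (diagonal d))) :
    Tendsto (fun x => T * (compression T (D x))⁻¹ * T) f
      (𝓝 (T * (compression T (diagonal d))⁻¹ * T)) := by
  have hc : Continuous fun D : Matrix γ γ ℝ => compression T D := by
    unfold compression; fun_prop
  have h1 := tendsto_matrix_inv ((hc.tendsto _).comp h)
    (compression_posDef hT hTT hd).det_pos.ne'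
  have hc2 : Continuous fun A : Matrix γ γ ℝ => T * A * T := by fun_prop
  exact (hc2.tendsto _).comp h1

end Projector

/-! ### Limits of the design -/

/-- If the quadratic means of a sequence converge, no single term dominates, so that the sum of fourth
powers is of smaller order than the squared length. -/
theorem tendsto_sum_pow_four {x : ℕ → ℝ} {b : ℝ}
    (h : Tendsto (fun s : ℕ => (s : ℝ)⁻¹ * ∑ j ∈ Finset.range s, x j * x j) atTop (𝓝 b)) :
    Tendsto (fun s : ℕ => ((s : ℝ) ^ 2)⁻¹ * ∑ j ∈ Finset.range s, x j ^ 4) atTop (𝓝 0) := by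
  have hlast : Tendsto (fun s : ℕ => x s ^ 2 / (s + 1 : ℝ)) atTop (𝓝 0) := by
    have h1 := (tendsto_add_atTop_iff_nat 1).2 h
    have h2 : Tendsto (fun s : ℕ => (s : ℝ) / (s + 1)) atTop (𝓝 1) := tendsto_natCast_div_add_atTop 1
    have h3 := h1.sub (h2.mul h)
    rw [one_mul, sub_self] at h3
    refine h3.congr fun s => ?_
    rw [Finset.sum_range_succ]
    push_cast
    rcases Nat.eq_zero_or_pos s with rfl | hs
    · simp [sq]
    · have : (s : ℝ) ≠ 0 := by positivity
      field_simp
      ring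
  have hg : Tendsto (fun s : ℕ => (s : ℝ)⁻¹ * ∑ j ∈ Finset.range s, (x j ^ 2 + 1)) atTop
      (𝓝 (b + 1)) := by
    have h2 : Tendsto (fun s : ℕ => (s : ℝ)⁻¹ * s) atTop (𝓝 1) := by
      refine tendsto_const_nhds.congr' ?_
      filter_upwards [eventually_gt_atTop 0] with s hs
      have : (s : ℝ) ≠ 0 := by positivity
      field_simp
    refine (h.add h2).congr fun s => ?_
    rw [Finset.sum_add_distrib, mul_add]
    simp [sq]
  have hgtop : Tendsto (fun s : ℕ => ∑ j ∈ Finset.range s, (x j ^ 2 + 1)) atTop atTop := by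
    refine tendsto_atTop_mono (fun s => ?_) tendsto_natCast_atTop_atTop
    calc (s : ℝ) = ∑ j ∈ Finset.range s, (1 : ℝ) := by simp
      _ ≤ _ := Finset.sum_le_sum fun j _ => by nlinarith [sq_nonneg (x j)]
  have hlo : (fun j : ℕ => x j ^ 2 * (x j ^ 2 / (j + 1 : ℝ))) =o[atTop] fun j => x j ^ 2 + 1 := by
    have h1 : (fun j : ℕ => x j ^ 2) =O[atTop] fun j => x j ^ 2 + 1 := by
      refine Asymptotics.IsBigO.of_bound 1 (Eventually.of_forall fun j => ?_)
      rw [Real.norm_of_nonneg (by positivity), Real.norm_of_nonneg (by positivity)]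
      linarith
    have h2 : (fun j : ℕ => x j ^ 2 / (j + 1 : ℝ)) =o[atTop] fun _ => (1 : ℝ) :=
      (Asymptotics.isLittleO_one_iff ℝ).2 hlast
    simpa using h1.mul_isLittleO h2
  have hsum := hlo.sum_range (fun j => by positivity) hgtop
  have hz : Tendsto (fun s : ℕ => (s : ℝ)⁻¹ *
      ∑ j ∈ Finset.range s, x j ^ 2 * (x j ^ 2 / (j + 1 : ℝ))) atTop (𝓝 0) := by
    have h1 : (fun s : ℕ => (s : ℝ)⁻¹ * ∑ j ∈ Finset.range s, x j ^ 2 * (x j ^ 2 / (j + 1 : ℝ)))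
        =o[atTop] fun s => (s : ℝ)⁻¹ * ∑ j ∈ Finset.range s, (x j ^ 2 + 1) :=
      (Asymptotics.isBigO_refl _ _).mul_isLittleO hsum
    exact (Asymptotics.isLittleO_one_iff ℝ).1 (h1.trans_isBigO (hg.isBigO_one ℝ))
  refine squeeze_zero (fun s => by positivity) (fun s => ?_) hz
  rcases Nat.eq_zero_or_pos s with rfl | hs
  · simp
  · have hs' : (0 : ℝ) < s := by positivity
    rw [sq, mul_inv, mul_assoc]
    refine mul_le_mul_of_nonneg_left ?_ (by positivity)
    rw [Finset.mul_sum]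
    refine Finset.sum_le_sum fun j hj => ?_
    have hjs : (j : ℝ) + 1 ≤ s := by exact_mod_cast Finset.mem_range.1 hj
    have : (s : ℝ)⁻¹ ≤ ((j : ℝ) + 1)⁻¹ := inv_anti₀ (by positivity) hjs
    calc (s : ℝ)⁻¹ * x j ^ 4 ≤ ((j : ℝ) + 1)⁻¹ * x j ^ 4 := by gcongr
      _ = _ := by field_simp

/-- The row of the design matrix that belongs to subject `j` of group `i`. -/
def row {a c : ℕ} (z : Fin a → ℕ → Fin c → ℝ) (i : Fin a) (j : ℕ) : Fin a ⊕ Fin c → ℝ :=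
  Sum.elim (Pi.single i 1) (z i j)

theorem design_apply {a c : ℕ} (z : Fin a → ℕ → Fin c → ℝ) (n : Fin a → ℕ) (s : Subj n)
    (v : Fin a ⊕ Fin c) : design z n s v = row z s.1 s.2 v := rfl

/-- The assumptions on the sequence of designs: group sizes of the same order, convergent first and
second moments of the covariates, and a nonsingular limit of the Gram matrix. The index set of the
sequence is arbitrary, so that it may carry further parameters along. -/
structure DesignLimit {ι : Type*} {a c : ℕ} (l : Filter ι) (z : Fin a → ℕ → Fin c → ℝ)
    (n : ι → Fin a → ℕ) (κ : Fin a → ℝ) (m : Fin a → Fin c → ℝ)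
    (Ξ : Fin a → Matrix (Fin c) (Fin c) ℝ) : Prop where
  total_atTop : Tendsto (fun t => total (n t)) l atTop
  pos : ∀ i, 0 < κ i
  size : ∀ i, Tendsto (fun t => (total (n t) : ℝ) / n t i) l (𝓝 (κ i))
  det_ne_zero : (limGram κ m Ξ).det ≠ 0
  first : ∀ i w, Tendsto (fun s : ℕ => (s : ℝ)⁻¹ * ∑ j ∈ Finset.range s, z i j w) atTop (𝓝 (m i w))
  second : ∀ i w v, Tendsto (fun s : ℕ => (s : ℝ)⁻¹ * ∑ j ∈ Finset.range s, z i j w * z i j v)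
    atTop (𝓝 (Ξ i w v))

namespace DesignLimit

variable {ι : Type*} {a c : ℕ} {l : Filter ι} {z : Fin a → ℕ → Fin c → ℝ}
  {n : ι → Fin a → ℕ} {κ : Fin a → ℝ} {m : Fin a → Fin c → ℝ}
  {Ξ : Fin a → Matrix (Fin c) (Fin c) ℝ}

theorem total_pos (h : DesignLimit l z n κ m Ξ) : ∀ᶠ t in l, (0 : ℝ) < total (n t) := by
  filter_upwards [h.total_atTop.eventually_gt_atTop 0] with t ht
  exact_mod_cast ht

theorem inv_total (h : DesignLimit l z n κ m Ξ) :
    Tendsto (fun t => ((total (n t) : ℝ))⁻¹) l (𝓝 0) :=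
  tendsto_inv_atTop_zero.comp (tendsto_natCast_atTop_atTop.comp h.total_atTop)

theorem size_div (h : DesignLimit l z n κ m Ξ) (i : Fin a) :
    Tendsto (fun t => (total (n t) : ℝ)⁻¹ * n t i) l (𝓝 (κ i)⁻¹) := by
  refine ((h.size i).inv₀ (h.pos i).ne').congr fun t => ?_
  rw [inv_div, div_eq_inv_mul]

theorem size_atTop (h : DesignLimit l z n κ m Ξ) (i : Fin a) :
    Tendsto (fun t => n t i) l atTop := by
  rw [← tendsto_natCast_atTop_iff (R := ℝ)]
  have h1 := (tendsto_natCast_atTop_atTop (R := ℝ)).comp h.total_atTop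
  refine (h1.atTop_mul_pos (inv_pos.2 (h.pos i)) (h.size_div i)).congr' ?_
  filter_upwards [h.total_pos] with t ht
  simp only [Function.comp]
  field_simp

theorem row_second (h : DesignLimit l z n κ m Ξ) (i : Fin a) (v w : Fin a ⊕ Fin c) :
    Tendsto (fun s : ℕ => (s : ℝ)⁻¹ * ∑ j ∈ Finset.range s, row z i j v * row z i j w) atTop
      (𝓝 (fromBlocks (vecMulVec (Pi.single i 1) (Pi.single i 1))
        (vecMulVec (Pi.single i 1) (m i)) (vecMulVec (m i) (Pi.single i 1)) (Ξ i) v w)) := by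
  rcases v with v | v <;> rcases w with w | w
  · simp only [row, Sum.elim_inl, fromBlocks_apply₁₁, vecMulVec_apply]
    refine tendsto_const_nhds.congr' ?_
    filter_upwards [eventually_gt_atTop 0] with s hs
    have : (s : ℝ) ≠ 0 := by positivity
    simp [this]
  · simp only [row, Sum.elim_inl, Sum.elim_inr, fromBlocks_apply₁₂, vecMulVec_apply]
    refine ((h.first i w).const_mul (Pi.single (M := fun _ => ℝ) i 1 v)).congr fun s => ?_
    rw [← Finset.mul_sum]; ring
  · simp only [row, Sum.elim_inl, Sum.elim_inr, fromBlocks_apply₂₁, vecMulVec_apply]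
    refine ((h.first i v).mul_const (Pi.single (M := fun _ => ℝ) i 1 w)).congr fun s => ?_
    rw [← Finset.sum_mul]; ring
  · exact h.second i v w

theorem groupGram (h : DesignLimit l z n κ m Ξ) (i : Fin a) (v w : Fin a ⊕ Fin c) :
    Tendsto (fun t => (total (n t) : ℝ)⁻¹ * ∑ j : Fin (n t i), row z i j v * row z i j w) l
      (𝓝 (limGroupGram κ m Ξ i v w)) := by
  have h1 := (h.size_div i).mul ((h.row_second i v w).comp (h.size_atTop i))
  refine h1.congr' ?_
  filter_upwards [(h.size_atTop i).eventually_gt_atTop 0] with t ht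
  have : (n t i : ℝ) ≠ 0 := by positivity
  simp only [Function.comp]
  rw [Fin.sum_univ_eq_sum_range (fun j => row z i j v * row z i j w)]
  field_simp

theorem sum_row_pow_four (h : DesignLimit l z n κ m Ξ) (i : Fin a) (v : Fin a ⊕ Fin c) :
    Tendsto (fun t => ((total (n t) : ℝ) ^ 2)⁻¹ * ∑ j : Fin (n t i), row z i j v ^ 4) l (𝓝 0) := by
  have h1 := ((h.size_div i).pow 2).mul
    ((tendsto_sum_pow_four (h.row_second i v v)).comp (h.size_atTop i))
  rw [mul_zero] at h1
  refine h1.congr' ?_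
  filter_upwards [(h.size_atTop i).eventually_gt_atTop 0] with t ht
  have : (n t i : ℝ) ≠ 0 := by positivity
  simp only [Function.comp]
  rw [Fin.sum_univ_eq_sum_range (fun j => row z i j v ^ 4)]
  field_simp

theorem gram (h : DesignLimit l z n κ m Ξ) :
    Tendsto (fun t => (total (n t) : ℝ)⁻¹ • ((design z (n t))ᵀ * design z (n t))) l
      (𝓝 (limGram κ m Ξ)) := by
  refine tendsto_pi_nhds.2 fun v => tendsto_pi_nhds.2 fun w => ?_
  have := tendsto_finsetSum Finset.univ fun i _ => h.groupGram i v w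
  simp only [limGram, Matrix.sum_apply]
  refine this.congr fun t => ?_
  rw [Matrix.smul_apply, Matrix.mul_apply, Fintype.sum_sigma, smul_eq_mul, Finset.mul_sum]
  rfl

theorem invGram (h : DesignLimit l z n κ m Ξ) :
    Tendsto (fun t => ((total (n t) : ℝ)⁻¹ • ((design z (n t))ᵀ * design z (n t)))⁻¹) l
      (𝓝 (limGram κ m Ξ)⁻¹) :=
  tendsto_matrix_inv h.gram h.det_ne_zero

theorem isUnit_det (h : DesignLimit l z n κ m Ξ) :
    ∀ᶠ t in l, IsUnit ((design z (n t))ᵀ * design z (n t)).det := by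
  have h1 := ((continuous_id.matrix_det).tendsto _).comp h.gram
  filter_upwards [h1.eventually_ne h.det_ne_zero] with t ht
  simp only [Function.comp, id, det_smul] at ht
  exact (right_ne_zero_of_mul ht).isUnit

/-- The degrees of freedom `n_i - c - 1` are asymptotically equivalent to `n_i`. -/
theorem total_div_dof (h : DesignLimit l z n κ m Ξ) (i : Fin a) :
    Tendsto (fun t => (total (n t) : ℝ) * ((n t i : ℝ) - c - 1)⁻¹) l (𝓝 (κ i)) := by
  have h1 : Tendsto (fun t => (total (n t) : ℝ)⁻¹ * n t i - (total (n t) : ℝ)⁻¹ * (c + 1)) l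
      (𝓝 ((κ i)⁻¹ - 0 * (c + 1))) := (h.size_div i).sub (h.inv_total.mul_const _)
  rw [zero_mul, sub_zero] at h1
  have h2 := h1.inv₀ (inv_pos.2 (h.pos i)).ne'
  rw [inv_inv] at h2
  refine h2.congr fun t => ?_
  rw [← mul_sub, mul_inv, inv_inv]
  congr 2
  ring

theorem dof_pos (h : DesignLimit l z n κ m Ξ) :
    ∀ᶠ t in l, ∀ i, 0 < (n t i : ℝ) - c - 1 := by
  refine eventually_all.2 fun i => ?_
  filter_upwards [(h.size_atTop i).eventually_gt_atTop (c + 1)] with t ht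
  have : ((c + 1 : ℕ) : ℝ) < n t i := by exact_mod_cast ht
  push_cast at this
  linarith

end DesignLimit

/-! ### The statistic as a quadratic form in the normalized score -/

/-- The normalized score `N^{-1/2} ∑_s x_s ⊗ Y_s`. -/
noncomputable def score {a c p : ℕ} (z : Fin a → ℕ → Fin c → ℝ) (n : Fin a → ℕ)
    (Y : Subj n → Fin p → ℝ) : EuclideanSpace ℝ ((Fin a ⊕ Fin c) × Fin p) :=
  WithLp.toLp 2 fun vk => (√(total n : ℝ))⁻¹ * ∑ s : Subj n, row z s.1 s.2 vk.1 * Y s vk.2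

/-- The rows of `A ⊗ I_p` that belong to the adjusted means. -/
noncomputable def meanRows {a c : ℕ} (p : ℕ) (A : Matrix (Fin a ⊕ Fin c) (Fin a ⊕ Fin c) ℝ) :
    Matrix (Fin a × Fin p) ((Fin a ⊕ Fin c) × Fin p) ℝ :=
  (A ⊗ₖ (1 : Matrix (Fin p) (Fin p) ℝ)).submatrix (Prod.map Sum.inl id) id

/-- The matrix of the MANCATS as a quadratic form in the score, as a function of the inverse `A` of
the normalized Gram matrix and of the normalized diagonal matrix `D` of variance estimators. -/
noncomputable def formMatrix {a c p : ℕ} (T : Matrix (Fin a × Fin p) (Fin a × Fin p) ℝ)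
    (A : Matrix (Fin a ⊕ Fin c) (Fin a ⊕ Fin c) ℝ) (D : Matrix (Fin a × Fin p) (Fin a × Fin p) ℝ) :
    Matrix ((Fin a ⊕ Fin c) × Fin p) ((Fin a ⊕ Fin c) × Fin p) ℝ :=
  (meanRows p A)ᵀ * (T * (compression T D)⁻¹ * T) * meanRows p A

theorem meanRows_mulVec {a c p : ℕ} (A : Matrix (Fin a ⊕ Fin c) (Fin a ⊕ Fin c) ℝ)
    (V : (Fin a ⊕ Fin c) × Fin p → ℝ) (ik : Fin a × Fin p) :
    (meanRows p A *ᵥ V) ik = ∑ w, A (Sum.inl ik.1) w * V (w, ik.2) := by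
  simp [meanRows, mulVec, dotProduct, Fintype.sum_prod_type, Matrix.one_apply]

theorem adjMeans_ols {a c p : ℕ} (z : Fin a → ℕ → Fin c → ℝ) (n : Fin a → ℕ)
    (Y : Subj n → Fin p → ℝ) (hN : (0 : ℝ) < total n)
    (hdet : IsUnit ((design z n)ᵀ * design z n).det) :
    adjMeans (ols z n Y) = (√(total n : ℝ))⁻¹ •
      (meanRows p ((total n : ℝ)⁻¹ • ((design z n)ᵀ * design z n))⁻¹ *ᵥ (score z n Y)) := by
  ext ik
  have hinv : ((total n : ℝ)⁻¹ • ((design z n)ᵀ * design z n))⁻¹ =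
      (total n : ℝ) • ((design z n)ᵀ * design z n)⁻¹ := by
    have : Invertible ((total n : ℝ)⁻¹) := invertibleOfNonzero (inv_ne_zero hN.ne')
    rw [inv_smul _ _ hdet]
    simp
  rw [Pi.smul_apply, meanRows_mulVec, hinv, adjMeans, ols, Matrix.mul_assoc, Matrix.mul_apply,
    smul_eq_mul, Finset.mul_sum]
  refine Finset.sum_congr rfl fun w _ => ?_
  have e : ((design z n)ᵀ * Matrix.of Y) w ik.2 = ∑ s : Subj n, row z s.1 s.2 w * Y s ik.2 := by
    rw [Matrix.mul_apply]; rfl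
  rw [e, Matrix.smul_apply, smul_eq_mul]
  simp only [score]
  have hs : (√(total n : ℝ))⁻¹ * (√(total n : ℝ))⁻¹ * (total n : ℝ) = 1 := by
    rw [← mul_inv, Real.mul_self_sqrt hN.le, inv_mul_cancel₀ hN.ne']
  linear_combination (-((design z n)ᵀ * design z n)⁻¹ (Sum.inl ik.1) w *
    ∑ s : Subj n, row z s.1 s.2 w * Y s ik.2) * hs

theorem dotProduct_transpose_mul_mul_mulVec {γ δ : Type*} [Fintype γ] [Fintype δ]
    (Q : Matrix γ δ ℝ) (M : Matrix γ γ ℝ) (V : δ → ℝ) :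
    V ⬝ᵥ ((Qᵀ * M * Q) *ᵥ V) = (Q *ᵥ V) ⬝ᵥ (M *ᵥ (Q *ᵥ V)) := by
  rw [← mulVec_mulVec, ← mulVec_mulVec, dotProduct_mulVec V, vecMul_transpose]

theorem tendsto_matrix_mul {X α β γ : Type*} [Fintype β] {f : Filter X}
    {A : X → Matrix α β ℝ} {A₀ : Matrix α β ℝ} (hA : Tendsto A f (𝓝 A₀))
    {B : X → Matrix β γ ℝ} {B₀ : Matrix β γ ℝ} (hB : Tendsto B f (𝓝 B₀)) :
    Tendsto (fun x => A x * B x) f (𝓝 (A₀ * B₀)) := by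
  refine tendsto_pi_nhds.2 fun i => tendsto_pi_nhds.2 fun k => ?_
  simp only [Matrix.mul_apply]
  exact tendsto_finsetSum _ fun j _ =>
    (tendsto_pi_nhds.1 (tendsto_pi_nhds.1 hA i) j).mul
      (tendsto_pi_nhds.1 (tendsto_pi_nhds.1 hB j) k)

theorem tendsto_transpose_mul_mul {X γ δ : Type*} [Fintype γ] [Fintype δ] {f : Filter X}
    {Q : X → Matrix γ δ ℝ} {Q₀ : Matrix γ δ ℝ} (hQ : Tendsto Q f (𝓝 Q₀))
    {M : X → Matrix γ γ ℝ} {M₀ : Matrix γ γ ℝ} (hM : Tendsto M f (𝓝 M₀)) :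
    Tendsto (fun x => (Q x)ᵀ * M x * Q x) f (𝓝 (Q₀ᵀ * M₀ * Q₀)) := by
  have hQt : Tendsto (fun x => (Q x)ᵀ) f (𝓝 Q₀ᵀ) :=
    tendsto_pi_nhds.2 fun i => tendsto_pi_nhds.2 fun k =>
      tendsto_pi_nhds.1 (tendsto_pi_nhds.1 hQ k) i
  exact tendsto_matrix_mul (tendsto_matrix_mul hQt hM) hQ

theorem mancats_eq {a c p : ℕ} (z : Fin a → ℕ → Fin c → ℝ) (n : Fin a → ℕ)
    {T : Matrix (Fin a × Fin p) (Fin a × Fin p) ℝ} (hT : Tᵀ = T) (hTT : T * T = T)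
    (Y : Subj n → Fin p → ℝ) (hN : (0 : ℝ) < total n)
    (hdet : IsUnit ((design z n)ᵀ * design z n).det)
    (hpos : ∀ ik, 0 < (total n : ℝ) * diagEst z n Y ik ik) :
    mancats z n T Y = (score z n Y) ⬝ᵥ
      (formMatrix T ((total n : ℝ)⁻¹ • ((design z n)ᵀ * design z n))⁻¹
        ((total n : ℝ) • diagEst z n Y) *ᵥ (score z n Y)) := by
  set A := ((total n : ℝ)⁻¹ • ((design z n)ᵀ * design z n))⁻¹
  have hd : (total n : ℝ) • diagEst z n Y =
      diagonal fun ik => (total n : ℝ) * diagEst z n Y ik ik := by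
    ext x y
    by_cases h : x = y
    · subst h; simp
    · simp [diagEst, h]
  have hp : Tᵀ * pinv (T * diagEst z n Y * T) * T =
      (total n : ℝ) • (T * (compression T ((total n : ℝ) • diagEst z n Y))⁻¹ * T) := by
    have e : T * diagEst z n Y * T =
        (total n : ℝ)⁻¹ • (T * ((total n : ℝ) • diagEst z n Y) * T) := by
      simp [smul_smul, hN.ne']
    rw [e, pinv_smul _ (inv_ne_zero hN.ne'), inv_inv]
    have := mul_pinv_mul_eq hT hTT hpos
    rw [← hd] at this
    rw [Matrix.mul_smul, Matrix.smul_mul, this]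
  have hs : (√(total n : ℝ))⁻¹ * ((√(total n : ℝ))⁻¹ * (total n : ℝ)) = 1 := by
    rw [← mul_assoc, ← mul_inv, Real.mul_self_sqrt hN.le, inv_mul_cancel₀ hN.ne']
  rw [mancats, adjMeans_ols z n Y hN hdet, hp, smul_mulVec, mulVec_smul, dotProduct_smul,
    smul_dotProduct, dotProduct_smul, formMatrix, dotProduct_transpose_mul_mul_mulVec]
  simp only [smul_eq_mul]
  linear_combination (meanRows p A *ᵥ (score z n Y) ⬝ᵥ
    ((T * (compression T ((total n : ℝ) • diagEst z n Y))⁻¹ * T) *ᵥ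
      (meanRows p A *ᵥ (score z n Y)))) * hs

theorem tendsto_formMatrix {X : Type*} {f : Filter X} {a c p : ℕ}
    {T : Matrix (Fin a × Fin p) (Fin a × Fin p) ℝ} (hT : Tᵀ = T) (hTT : T * T = T)
    {A : X → Matrix (Fin a ⊕ Fin c) (Fin a ⊕ Fin c) ℝ}
    {A₀ : Matrix (Fin a ⊕ Fin c) (Fin a ⊕ Fin c) ℝ} (hA : Tendsto A f (𝓝 A₀))
    {D : X → Matrix (Fin a × Fin p) (Fin a × Fin p) ℝ} {d : Fin a × Fin p → ℝ}
    (hd : ∀ i, 0 < d i) (hD : Tendsto D f (𝓝 (diagonal d))) :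
    Tendsto (fun x => formMatrix T (A x) (D x)) f (𝓝 (formMatrix T A₀ (diagonal d))) := by
  have hc : Continuous fun A : Matrix (Fin a ⊕ Fin c) (Fin a ⊕ Fin c) ℝ => meanRows p A := by
    refine continuous_matrix fun i j => ?_
    simp only [meanRows, submatrix_apply, kroneckerMap_apply]
    fun_prop
  exact tendsto_transpose_mul_mul ((hc.tendsto A₀).comp hA) (tendsto_compression_inv hT hTT hd hD)

theorem covEst_apply {a c p : ℕ} (z : Fin a → ℕ → Fin c → ℝ) (n : Fin a → ℕ)
    (Y : Subj n → Fin p → ℝ) (i : Fin a) (k l : Fin p) (hN : (0 : ℝ) < total n) :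
    covEst z n Y i k l = ((total n : ℝ) * ((n i : ℝ) - c - 1)⁻¹) *
      ((total n : ℝ)⁻¹ * ∑ j : Fin (n i), Y ⟨i, j⟩ k * Y ⟨i, j⟩ l
        - ∑ w, ols z n Y w l * ((total n : ℝ)⁻¹ * ∑ j : Fin (n i), row z i j w * Y ⟨i, j⟩ k)
        - ∑ w, ols z n Y w k * ((total n : ℝ)⁻¹ * ∑ j : Fin (n i), row z i j w * Y ⟨i, j⟩ l)
        + ∑ w, ∑ v, ols z n Y w k * ols z n Y v l *
            ((total n : ℝ)⁻¹ * ∑ j : Fin (n i), row z i j w * row z i j v)) := by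
  set N : ℝ := (total n : ℝ) with hNdef
  set Δ := ols z n Y
  have hu : ∀ j : Fin (n i), resid z n Y ⟨i, j⟩ k * resid z n Y ⟨i, j⟩ l =
      Y ⟨i, j⟩ k * Y ⟨i, j⟩ l - ∑ w, Δ w l * (row z i j w * Y ⟨i, j⟩ k)
        - ∑ w, Δ w k * (row z i j w * Y ⟨i, j⟩ l)
        + ∑ w, ∑ v, Δ w k * Δ v l * (row z i j w * row z i j v) := by
    intro j
    have e : ∀ k, resid z n Y ⟨i, j⟩ k = Y ⟨i, j⟩ k - ∑ w, row z i j w * Δ w k := fun k => by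
      simp only [resid, Matrix.mul_apply]; rfl
    rw [e, e, sub_mul, mul_sub, mul_sub, Finset.sum_mul_sum, Finset.mul_sum, Finset.sum_mul]
    have e1 : ∑ w, ∑ v, row z i j w * Δ w k * (row z i j v * Δ v l) =
        ∑ w, ∑ v, Δ w k * Δ v l * (row z i j w * row z i j v) :=
      Finset.sum_congr rfl fun w _ => Finset.sum_congr rfl fun v _ => by ring
    have e2 : ∑ w, Y ⟨i, j⟩ k * (row z i j w * Δ w l) = ∑ w, Δ w l * (row z i j w * Y ⟨i, j⟩ k) :=
      Finset.sum_congr rfl fun w _ => by ring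
    have e3 : ∑ w, row z i j w * Δ w k * Y ⟨i, j⟩ l = ∑ w, Δ w k * (row z i j w * Y ⟨i, j⟩ l) :=
      Finset.sum_congr rfl fun w _ => by ring
    rw [e1, e2, e3]
    ring
  have hcov : covEst z n Y i k l =
      ((n i : ℝ) - c - 1)⁻¹ * ∑ j : Fin (n i), resid z n Y ⟨i, j⟩ k * resid z n Y ⟨i, j⟩ l := by
    simp [covEst, Matrix.sum_apply, vecMulVec_apply]
  have s1 : ∀ (f : Fin a ⊕ Fin c → ℝ) (g : Fin a ⊕ Fin c → Fin (n i) → ℝ),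
      ∑ j, ∑ w, f w * g w j = N * ∑ w, f w * (N⁻¹ * ∑ j, g w j) := by
    intro f g
    rw [Finset.sum_comm, Finset.mul_sum]
    refine Finset.sum_congr rfl fun w _ => ?_
    rw [← Finset.mul_sum]
    field_simp
  rw [hcov, Finset.sum_congr rfl fun j _ => hu j, Finset.sum_add_distrib, Finset.sum_sub_distrib,
    Finset.sum_sub_distrib, s1, s1]
  have s2 : ∑ j : Fin (n i), ∑ w, ∑ v, Δ w k * Δ v l * (row z i j w * row z i j v) =
      N * ∑ w, ∑ v, Δ w k * Δ v l * (N⁻¹ * ∑ j : Fin (n i), row z i j w * row z i j v) := by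
    rw [Finset.sum_comm, Finset.mul_sum]
    exact Finset.sum_congr rfl fun w _ => s1 _ _
  rw [s2]
  field_simp

/-! ### Arrays of independent errors -/

/-- Rows of independent centred error vectors, one row for each index `t`, each on its own probability
space, with covariances `Σt t i` that converge to `S i` and eventually uniformly bounded fourth
moments. Both the errors of the model and, as the index runs over pairs of a sample size and a
covariance matrix, the bootstrap samples are of this kind. -/
structure ErrorArray {ι : Type*} {a p : ℕ} (l : Filter ι) (n : ι → Fin a → ℕ) {Ω : ι → Type*}
    [∀ t, MeasurableSpace (Ω t)] (P : ∀ t, Measure (Ω t))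
    (e : ∀ t, Ω t → Subj (n t) → Fin p → ℝ) (St : ι → Fin a → Matrix (Fin p) (Fin p) ℝ)
    (S : Fin a → Matrix (Fin p) (Fin p) ℝ) (C : ℝ) : Prop where
  meas : ∀ t s, Measurable fun ω => e t ω s
  indep : ∀ t, iIndepFun (fun s ω => e t ω s) (P t)
  mean : ∀ t s k, ∫ ω, e t ω s k ∂P t = 0
  second : ∀ t s k l, ∫ ω, e t ω s k * e t ω s l ∂P t = St t s.1 k l
  fourth_integrable : ∀ t s k, Integrable (fun ω => e t ω s k ^ 4) (P t)
  fourth_le : ∀ᶠ t in l, ∀ s k, ∫ ω, e t ω s k ^ 4 ∂P t ≤ C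
  tendsto_cov : Tendsto St l (𝓝 S)

/-- The limit of the covariance matrix of the normalized score. -/
noncomputable def limScoreCov {a c p : ℕ} (κ : Fin a → ℝ) (m : Fin a → Fin c → ℝ)
    (Ξ : Fin a → Matrix (Fin c) (Fin c) ℝ) (S : Fin a → Matrix (Fin p) (Fin p) ℝ) :
    Matrix ((Fin a ⊕ Fin c) × Fin p) ((Fin a ⊕ Fin c) × Fin p) ℝ :=
  ∑ i, limGroupGram κ m Ξ i ⊗ₖ S i

theorem sum_pow_four_le {γ : Type*} [Fintype γ] (b : γ → ℝ) :
    (∑ q, b q) ^ 4 ≤ (Fintype.card γ : ℝ) ^ 3 * ∑ q, b q ^ 4 := by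
  have h1 : (∑ q, b q) ^ 2 ≤ (Fintype.card γ : ℝ) * ∑ q, b q ^ 2 := by
    simpa using sq_sum_le_card_mul_sum_sq (s := Finset.univ) (f := b)
  have h2 : (∑ q, b q ^ 2) ^ 2 ≤ (Fintype.card γ : ℝ) * ∑ q, b q ^ 4 := by
    have := sq_sum_le_card_mul_sum_sq (s := Finset.univ) (f := fun q => b q ^ 2)
    simpa [← pow_mul] using this
  calc (∑ q, b q) ^ 4 = ((∑ q, b q) ^ 2) ^ 2 := by ring
    _ ≤ ((Fintype.card γ : ℝ) * ∑ q, b q ^ 2) ^ 2 := by gcongr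
    _ = (Fintype.card γ : ℝ) ^ 2 * (∑ q, b q ^ 2) ^ 2 := by ring
    _ ≤ (Fintype.card γ : ℝ) ^ 2 * ((Fintype.card γ : ℝ) * ∑ q, b q ^ 4) := by gcongr
    _ = _ := by ring

namespace ErrorArray

variable {ι : Type*} {a c p : ℕ} {l : Filter ι} {z : Fin a → ℕ → Fin c → ℝ}
  {n : ι → Fin a → ℕ} {κ : Fin a → ℝ} {m : Fin a → Fin c → ℝ}
  {Ξ : Fin a → Matrix (Fin c) (Fin c) ℝ}
  {Ω : ι → Type*} [∀ t, MeasurableSpace (Ω t)] {P : ∀ t, Measure (Ω t)}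
  {e : ∀ t, Ω t → Subj (n t) → Fin p → ℝ} {St : ι → Fin a → Matrix (Fin p) (Fin p) ℝ}
  {S : Fin a → Matrix (Fin p) (Fin p) ℝ} {C : ℝ}

theorem meas_apply (hE : ErrorArray l n P e St S C) (t : ι) (s : Subj (n t)) (k : Fin p) :
    Measurable fun ω => e t ω s k :=
  (measurable_pi_apply k).comp (hE.meas t s)

theorem cov_apply (hE : ErrorArray l n P e St S C) (i : Fin a) (k k' : Fin p) :
    Tendsto (fun t => St t i k k') l (𝓝 (S i k k')) :=
  tendsto_pi_nhds.1 (tendsto_pi_nhds.1 (tendsto_pi_nhds.1 hE.tendsto_cov i) k) k'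

variable [∀ t, IsProbabilityMeasure (P t)]

theorem memLp (hE : ErrorArray l n P e St S C) (t : ι) (s : Subj (n t)) (k : Fin p) :
    MemLp (fun ω => e t ω s k) 2 (P t) :=
  memLp_two_of_pow_four (hE.meas_apply t s k) (hE.fourth_integrable t s k)

theorem tendsto_regressor_mul_error (hE : ErrorArray l n P e St S C)
    (hD : DesignLimit l z n κ m Ξ) (i : Fin a) (v : Fin a ⊕ Fin c) (k : Fin p) :
    Tendsto (fun s : Σ t, Ω t => (total (n s.1) : ℝ)⁻¹ *
      ∑ j : Fin (n s.1 i), row z i j v * e s.1 s.2 ⟨i, j⟩ k) (whp l P) (𝓝 0) := by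
  have key := tendsto_sum_whp (l := l) (P := P) (J := fun t => Fin (n t i))
    (X := fun t j ω => (total (n t) : ℝ)⁻¹ * row z i j v * e t ω ⟨i, j⟩ k) (c := 0)
    (fun t j => (hE.memLp t ⟨i, j⟩ k).const_mul _) (fun t => ?_) ?_ ?_
  · refine key.congr fun s => ?_
    rw [Finset.mul_sum]
    exact Finset.sum_congr rfl fun j _ => by ring
  · have h1 := (hE.indep t).precomp (g := fun j : Fin (n t i) => (⟨i, j⟩ : Subj (n t)))
      (fun _ _ h => by simpa using h)
    exact h1.comp (fun j x => (total (n t) : ℝ)⁻¹ * row z i j v * x k) fun j => by fun_prop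
  · simp [integral_const_mul, hE.mean, tendsto_const_nhds]
  · have h1 := (hD.inv_total.mul (hD.groupGram i v v)).mul (hE.cov_apply i k k)
    rw [zero_mul, zero_mul] at h1
    refine h1.congr fun t => ?_
    have h2 : ∀ j : Fin (n t i), ∫ ω, ((total (n t) : ℝ)⁻¹ * row z i j v * e t ω ⟨i, j⟩ k) ^ 2 ∂P t =
        (total (n t) : ℝ)⁻¹ * ((total (n t) : ℝ)⁻¹ * (row z i j v * row z i j v)) * St t i k k := by
      intro j
      rw [← hE.second t ⟨i, j⟩ k k, ← integral_const_mul]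
      congr 1
      ext ω
      ring
    rw [Finset.sum_congr rfl fun j _ => h2 j, ← Finset.sum_mul, ← Finset.mul_sum, ← Finset.mul_sum]

theorem tendsto_error_mul_error (hE : ErrorArray l n P e St S C)
    (hD : DesignLimit l z n κ m Ξ) (i : Fin a) (k k' : Fin p) :
    Tendsto (fun s : Σ t, Ω t => (total (n s.1) : ℝ)⁻¹ *
      ∑ j : Fin (n s.1 i), e s.1 s.2 ⟨i, j⟩ k * e s.1 s.2 ⟨i, j⟩ k') (whp l P)
      (𝓝 ((κ i)⁻¹ * S i k k')) := by
  have hsq : ∀ t (j : Fin (n t i)) ω, (e t ω ⟨i, j⟩ k * e t ω ⟨i, j⟩ k') ^ 2 ≤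
      e t ω ⟨i, j⟩ k ^ 4 + e t ω ⟨i, j⟩ k' ^ 4 := fun t j ω => by
    nlinarith [sq_nonneg (e t ω ⟨i, j⟩ k ^ 2 - e t ω ⟨i, j⟩ k' ^ 2), sq_nonneg (e t ω ⟨i, j⟩ k ^ 2),
      sq_nonneg (e t ω ⟨i, j⟩ k' ^ 2)]
  have hint : ∀ t (j : Fin (n t i)),
      Integrable (fun ω => (e t ω ⟨i, j⟩ k * e t ω ⟨i, j⟩ k') ^ 2) (P t) := fun t j => by
    refine ((hE.fourth_integrable t ⟨i, j⟩ k).add (hE.fourth_integrable t ⟨i, j⟩ k')).mono' ?_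
      (ae_of_all _ fun ω => ?_)
    · have := hE.meas_apply t ⟨i, j⟩ k
      have := hE.meas_apply t ⟨i, j⟩ k'
      fun_prop
    · rw [Real.norm_of_nonneg (sq_nonneg _)]
      exact hsq t j ω
  have key := tendsto_sum_whp (l := l) (P := P) (J := fun t => Fin (n t i))
    (X := fun t j ω => (total (n t) : ℝ)⁻¹ * (e t ω ⟨i, j⟩ k * e t ω ⟨i, j⟩ k'))
    (c := (κ i)⁻¹ * S i k k') (fun t j => ?_) (fun t => ?_) ?_ ?_
  · refine key.congr fun s => ?_
    rw [Finset.mul_sum]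
  · refine MemLp.const_mul ?_ _
    rw [memLp_two_iff_integrable_sq]
    · exact hint t j
    · exact ((hE.meas_apply t ⟨i, j⟩ k).mul (hE.meas_apply t ⟨i, j⟩ k')).aestronglyMeasurable
  · have h1 := (hE.indep t).precomp (g := fun j : Fin (n t i) => (⟨i, j⟩ : Subj (n t)))
      (fun _ _ h => by simpa using h)
    exact h1.comp (fun j x => (total (n t) : ℝ)⁻¹ * (x k * x k')) fun j => by fun_prop
  · refine ((hD.size_div i).mul (hE.cov_apply i k k')).congr fun t => ?_
    simp only [integral_const_mul, hE.second]
    simp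
    ring
  · have hlim : Tendsto (fun t => (total (n t) : ℝ)⁻¹ * ((total (n t) : ℝ)⁻¹ * n t i) * (2 * C)) l
        (𝓝 0) := by
      simpa using (hD.inv_total.mul (hD.size_div i)).mul_const (2 * C)
    refine squeeze_zero' (Eventually.of_forall fun t => Finset.sum_nonneg fun j _ =>
      integral_nonneg fun ω => sq_nonneg _) ?_ hlim
    filter_upwards [hE.fourth_le] with t ht
    have h2 : ∀ j : Fin (n t i),
        ∫ ω, ((total (n t) : ℝ)⁻¹ * (e t ω ⟨i, j⟩ k * e t ω ⟨i, j⟩ k')) ^ 2 ∂P t ≤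
        ((total (n t) : ℝ)⁻¹) ^ 2 * (2 * C) := by
      intro j
      simp only [mul_pow ((total (n t) : ℝ)⁻¹)]
      rw [integral_const_mul]
      refine mul_le_mul_of_nonneg_left ?_ (sq_nonneg _)
      calc _ ≤ ∫ ω, (e t ω ⟨i, j⟩ k ^ 4 + e t ω ⟨i, j⟩ k' ^ 4) ∂P t :=
            integral_mono (hint t j)
              ((hE.fourth_integrable t ⟨i, j⟩ k).add (hE.fourth_integrable t ⟨i, j⟩ k'))
              fun ω => hsq t j ω
        _ = _ := integral_add (hE.fourth_integrable t ⟨i, j⟩ k) (hE.fourth_integrable t ⟨i, j⟩ k')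
        _ ≤ C + C := add_le_add (ht _ _) (ht _ _)
        _ = 2 * C := by ring
    calc _ ≤ ∑ j : Fin (n t i), ((total (n t) : ℝ)⁻¹) ^ 2 * (2 * C) :=
          Finset.sum_le_sum fun j _ => h2 j
      _ = _ := by
        simp
        ring

/-- Consistency of the least squares estimator under vanishing coefficients. -/
theorem tendsto_ols (hE : ErrorArray l n P e St S C)
    (hD : DesignLimit l z n κ m Ξ) (v : Fin a ⊕ Fin c) (k : Fin p) :
    Tendsto (fun s : Σ t, Ω t => ols z (n s.1) (e s.1 s.2) v k) (whp l P) (𝓝 0) := by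
  have hA : ∀ w, Tendsto (fun s : Σ t, Ω t => ((total (n s.1) : ℝ)⁻¹ •
      ((design z (n s.1))ᵀ * design z (n s.1)))⁻¹ v w) (whp l P) (𝓝 ((limGram κ m Ξ)⁻¹ v w)) :=
    fun w => tendsto_pi_nhds.1 (tendsto_pi_nhds.1 (hD.invGram.comp tendsto_fst_whp) v) w
  have h1 : Tendsto (fun s : Σ t, Ω t => ∑ w, ((total (n s.1) : ℝ)⁻¹ •
      ((design z (n s.1))ᵀ * design z (n s.1)))⁻¹ v w * ∑ i, ((total (n s.1) : ℝ)⁻¹ *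
      ∑ j : Fin (n s.1 i), row z i j w * e s.1 s.2 ⟨i, j⟩ k)) (whp l P) (𝓝 0) := by
    have := tendsto_finsetSum Finset.univ fun w _ => (hA w).mul
      (tendsto_finsetSum Finset.univ fun i _ => hE.tendsto_regressor_mul_error hD i w k)
    simpa using this
  refine h1.congr' ?_
  filter_upwards [tendsto_fst_whp.eventually hD.isUnit_det,
    tendsto_fst_whp.eventually hD.total_pos] with s hdet hN
  have hinv : ((total (n s.1) : ℝ)⁻¹ • ((design z (n s.1))ᵀ * design z (n s.1)))⁻¹ =
      (total (n s.1) : ℝ) • ((design z (n s.1))ᵀ * design z (n s.1))⁻¹ := by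
    have : Invertible ((total (n s.1) : ℝ)⁻¹) := invertibleOfNonzero (inv_ne_zero hN.ne')
    rw [inv_smul _ _ hdet]
    simp
  rw [hinv, ols, Matrix.mul_assoc, Matrix.mul_apply]
  refine Finset.sum_congr rfl fun w _ => ?_
  rw [Matrix.mul_apply, Fintype.sum_sigma, ← Finset.mul_sum, Matrix.smul_apply, smul_eq_mul]
  simp only [transpose_apply, design_apply, Matrix.of_apply]
  field_simp

/-- Consistency of the groupwise residual covariance estimators. -/
theorem tendsto_covEst (hE : ErrorArray l n P e St S C)
    (hD : DesignLimit l z n κ m Ξ) (i : Fin a) (k k' : Fin p) :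
    Tendsto (fun s : Σ t, Ω t => covEst z (n s.1) (e s.1 s.2) i k k') (whp l P)
      (𝓝 (S i k k')) := by
  have hdof := (hD.total_div_dof i).comp (tendsto_fst_whp (l := l) (P := P))
  have hgram : ∀ w v, Tendsto (fun s : Σ t, Ω t => (total (n s.1) : ℝ)⁻¹ *
      ∑ j : Fin (n s.1 i), row z i j w * row z i j v) (whp l P) (𝓝 (limGroupGram κ m Ξ i w v)) :=
    fun w v => (hD.groupGram i w v).comp tendsto_fst_whp
  have h1 := (((hE.tendsto_error_mul_error hD i k k').sub
    (tendsto_finsetSum Finset.univ fun w _ => (hE.tendsto_ols hD w k').mul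
      (hE.tendsto_regressor_mul_error hD i w k))).sub
    (tendsto_finsetSum Finset.univ fun w _ => (hE.tendsto_ols hD w k).mul
      (hE.tendsto_regressor_mul_error hD i w k'))).add
    (tendsto_finsetSum Finset.univ fun w _ => tendsto_finsetSum Finset.univ fun v _ =>
      ((hE.tendsto_ols hD w k).mul (hE.tendsto_ols hD v k')).mul (hgram w v))
  have h2 := hdof.mul h1
  have e2 : κ i * ((κ i)⁻¹ * S i k k' - ∑ w : Fin a ⊕ Fin c, (0 : ℝ) * 0
      - ∑ w : Fin a ⊕ Fin c, (0 : ℝ) * 0 + ∑ w : Fin a ⊕ Fin c, ∑ v : Fin a ⊕ Fin c,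
        (0 : ℝ) * 0 * limGroupGram κ m Ξ i w v) = S i k k' := by
    have := (hD.pos i).ne'
    simp
    field_simp
  rw [e2] at h2
  refine h2.congr' ?_
  filter_upwards [tendsto_fst_whp.eventually hD.total_pos] with s hN
  rw [covEst_apply z (n s.1) (e s.1 s.2) i k k' hN]
  rfl

theorem tendsto_diagEst (hE : ErrorArray l n P e St S C) (hD : DesignLimit l z n κ m Ξ) :
    Tendsto (fun s : Σ t, Ω t => (total (n s.1) : ℝ) • diagEst z (n s.1) (e s.1 s.2)) (whp l P)
      (𝓝 (diagonal fun ik => κ ik.1 * S ik.1 ik.2 ik.2)) := by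
  refine tendsto_pi_nhds.2 fun x => tendsto_pi_nhds.2 fun y => ?_
  by_cases hxy : x = y
  · subst hxy
    have h1 := ((hD.size x.1).comp (tendsto_fst_whp (l := l) (P := P))).mul
      (hE.tendsto_covEst hD x.1 x.2 x.2)
    simp only [diagEst, Matrix.smul_apply, diagonal_apply_eq]
    refine h1.congr fun s => ?_
    simp only [Function.comp, smul_eq_mul]
    ring
  · simp only [diagEst, Matrix.smul_apply, diagonal_apply_ne _ hxy, smul_zero]
    exact tendsto_const_nhds

end ErrorArray

/-! ### The limiting law of the score and of the statistic -/

namespace ErrorArray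

variable {ι : Type*} {a c p : ℕ} {l : Filter ι} {z : Fin a → ℕ → Fin c → ℝ}
  {n : ι → Fin a → ℕ} {κ : Fin a → ℝ} {m : Fin a → Fin c → ℝ}
  {Ξ : Fin a → Matrix (Fin c) (Fin c) ℝ}
  {Ω : ι → Type*} [∀ t, MeasurableSpace (Ω t)] {P : ∀ t, Measure (Ω t)}
  {e : ∀ t, Ω t → Subj (n t) → Fin p → ℝ} {St : ι → Fin a → Matrix (Fin p) (Fin p) ℝ}
  {S : Fin a → Matrix (Fin p) (Fin p) ℝ} {C : ℝ}

/-- The contribution of subject `s` to the linear functional `θ` of the score. -/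
noncomputable def scoreTerm (z : Fin a → ℕ → Fin c → ℝ) (n : Fin a → ℕ)
    (θ : (Fin a ⊕ Fin c) × Fin p → ℝ) (s : Subj n) (y : Fin p → ℝ) : ℝ :=
  ∑ q, (√(total n : ℝ))⁻¹ * (θ q * row z s.1 s.2 q.1) * y q.2

theorem inner_score (z : Fin a → ℕ → Fin c → ℝ) (n : Fin a → ℕ) (Y : Subj n → Fin p → ℝ)
    (θ : EuclideanSpace ℝ ((Fin a ⊕ Fin c) × Fin p)) :
    inner ℝ (score z n Y) θ = ∑ s, scoreTerm z n θ s (Y s) := by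
  simp only [PiLp.inner_apply, score, scoreTerm, RCLike.inner_apply, conj_trivial]
  rw [Finset.sum_comm]
  refine Finset.sum_congr rfl fun q _ => ?_
  rw [Finset.mul_sum, Finset.mul_sum]
  exact Finset.sum_congr rfl fun s _ => by ring

theorem measurable_scoreTerm (z : Fin a → ℕ → Fin c → ℝ) (n : Fin a → ℕ)
    (θ : (Fin a ⊕ Fin c) × Fin p → ℝ) (s : Subj n) : Measurable (scoreTerm z n θ s) := by
  unfold scoreTerm
  fun_prop

theorem measurable_score (hE : ErrorArray l n P e St S C) (t : ι) :
    Measurable fun ω => score z (n t) (e t ω) := by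
  refine (WithLp.measurable_toLp 2 _).comp (measurable_pi_lambda _ fun q => ?_)
  have := fun s => hE.meas_apply t s q.2
  fun_prop

theorem scoreTerm_pow_four_le (z : Fin a → ℕ → Fin c → ℝ) (n : Fin a → ℕ)
    (θ : (Fin a ⊕ Fin c) × Fin p → ℝ) (s : Subj n) (y : Fin p → ℝ) :
    scoreTerm z n θ s y ^ 4 ≤ (Fintype.card ((Fin a ⊕ Fin c) × Fin p) : ℝ) ^ 3 *
      ∑ q, θ q ^ 4 * (((total n : ℝ) ^ 2)⁻¹ * row z s.1 s.2 q.1 ^ 4) * y q.2 ^ 4 := by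
  refine (sum_pow_four_le _).trans (le_of_eq ?_)
  congr 1
  refine Finset.sum_congr rfl fun q _ => ?_
  have h : ((√(total n : ℝ))⁻¹) ^ 4 = ((total n : ℝ) ^ 2)⁻¹ := by
    rw [inv_pow, show 4 = 2 * 2 by norm_num, pow_mul, Real.sq_sqrt (by positivity)]
  rw [mul_pow, mul_pow, mul_pow, h]
  ring

theorem iIndepFun_scoreTerm (hE : ErrorArray l n P e St S C)
    (θ : (Fin a ⊕ Fin c) × Fin p → ℝ) (t : ι) :
    iIndepFun (fun s ω => scoreTerm z (n t) θ s (e t ω s)) (P t) :=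
  (hE.indep t).comp (fun s => scoreTerm z (n t) θ s) fun s => measurable_scoreTerm z (n t) θ s

theorem integrable_scoreTerm_pow_four (hE : ErrorArray l n P e St S C)
    (θ : (Fin a ⊕ Fin c) × Fin p → ℝ) (t : ι) (s : Subj (n t)) :
    Integrable (fun ω => scoreTerm z (n t) θ s (e t ω s) ^ 4) (P t) := by
  have hi : Integrable (fun ω => (Fintype.card ((Fin a ⊕ Fin c) × Fin p) : ℝ) ^ 3 *
      ∑ q, θ q ^ 4 * (((total (n t) : ℝ) ^ 2)⁻¹ * row z s.1 s.2 q.1 ^ 4) * e t ω s q.2 ^ 4)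
      (P t) :=
    (integrable_finsetSum _ fun q _ => (hE.fourth_integrable t s q.2).const_mul _).const_mul _
  refine hi.mono' ?_ (ae_of_all _ fun ω => ?_)
  · exact (((measurable_scoreTerm z (n t) θ s).comp (hE.meas t s)).pow_const 4).aestronglyMeasurable
  · rw [Real.norm_of_nonneg (by positivity)]
    exact scoreTerm_pow_four_le z (n t) θ s _

theorem tendsto_sum_integral_scoreTerm_pow_four (hE : ErrorArray l n P e St S C)
    (hD : DesignLimit l z n κ m Ξ) (θ : (Fin a ⊕ Fin c) × Fin p → ℝ) :
    Tendsto (fun t => ∑ s, ∫ ω, scoreTerm z (n t) θ s (e t ω s) ^ 4 ∂P t) l (𝓝 0) := by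
  set K : ℝ := (Fintype.card ((Fin a ⊕ Fin c) × Fin p) : ℝ) ^ 3
  have hlim : Tendsto (fun t => K * ∑ q : (Fin a ⊕ Fin c) × Fin p, θ q ^ 4 *
      (∑ i, ((total (n t) : ℝ) ^ 2)⁻¹ * ∑ j : Fin (n t i), row z i j q.1 ^ 4) * C) l (𝓝 0) := by
    have := (tendsto_finsetSum Finset.univ fun (q : (Fin a ⊕ Fin c) × Fin p) _ =>
      ((tendsto_finsetSum Finset.univ fun i _ => hD.sum_row_pow_four i q.1).const_mul
        (θ q ^ 4)).mul_const C).const_mul K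
    simpa using this
  refine squeeze_zero' (Eventually.of_forall fun t => Finset.sum_nonneg fun s _ =>
    integral_nonneg fun ω => by positivity) ?_ hlim
  filter_upwards [hE.fourth_le] with t ht
  have h2 : ∀ s : Subj (n t), ∫ ω, scoreTerm z (n t) θ s (e t ω s) ^ 4 ∂P t ≤
      K * ∑ q, θ q ^ 4 * (((total (n t) : ℝ) ^ 2)⁻¹ * row z s.1 s.2 q.1 ^ 4) * C := by
    intro s
    have hi : ∀ q : (Fin a ⊕ Fin c) × Fin p, Integrable (fun ω => θ q ^ 4 *
        (((total (n t) : ℝ) ^ 2)⁻¹ * row z s.1 s.2 q.1 ^ 4) * e t ω s q.2 ^ 4) (P t) := fun q =>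
      (hE.fourth_integrable t s q.2).const_mul _
    refine (integral_mono (hE.integrable_scoreTerm_pow_four θ t s)
      ((integrable_finsetSum _ fun q _ => hi q).const_mul K)
      fun ω => scoreTerm_pow_four_le z (n t) θ s _).trans ?_
    rw [integral_const_mul, integral_finsetSum _ fun q _ => hi q]
    refine mul_le_mul_of_nonneg_left (Finset.sum_le_sum fun q _ => ?_) (by positivity)
    rw [integral_const_mul]
    exact mul_le_mul_of_nonneg_left (ht s q.2) (by positivity)
  refine (Finset.sum_le_sum fun s _ => h2 s).trans (le_of_eq ?_)
  rw [← Finset.mul_sum, Finset.sum_comm]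
  congr 1
  refine Finset.sum_congr rfl fun q _ => ?_
  rw [← Finset.sum_mul, ← Finset.mul_sum, Fintype.sum_sigma]
  congr 2
  refine Finset.sum_congr rfl fun i _ => ?_
  rw [Finset.mul_sum]

variable [∀ t, IsProbabilityMeasure (P t)]

theorem memLp_scoreTerm (hE : ErrorArray l n P e St S C)
    (θ : (Fin a ⊕ Fin c) × Fin p → ℝ) (t : ι) (s : Subj (n t)) :
    MemLp (fun ω => scoreTerm z (n t) θ s (e t ω s)) 2 (P t) :=
  memLp_two_of_pow_four ((measurable_scoreTerm z (n t) θ s).comp (hE.meas t s))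
    (hE.integrable_scoreTerm_pow_four θ t s)

theorem integral_scoreTerm (hE : ErrorArray l n P e St S C)
    (θ : (Fin a ⊕ Fin c) × Fin p → ℝ) (t : ι) (s : Subj (n t)) :
    ∫ ω, scoreTerm z (n t) θ s (e t ω s) ∂P t = 0 := by
  unfold scoreTerm
  rw [integral_finsetSum]
  · simp [integral_const_mul, hE.mean]
  · exact fun q _ => ((hE.memLp t s q.2).integrable (by norm_num)).const_mul _

theorem tendsto_sum_integral_scoreTerm_sq (hE : ErrorArray l n P e St S C)
    (hD : DesignLimit l z n κ m Ξ) (θ : (Fin a ⊕ Fin c) × Fin p → ℝ) :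
    Tendsto (fun t => ∑ s, ∫ ω, scoreTerm z (n t) θ s (e t ω s) ^ 2 ∂P t) l
      (𝓝 (θ ⬝ᵥ (limScoreCov κ m Ξ S *ᵥ θ))) := by
  have hlim : θ ⬝ᵥ (limScoreCov κ m Ξ S *ᵥ θ) =
      ∑ q, ∑ q', θ q * θ q' * ∑ i, limGroupGram κ m Ξ i q.1 q'.1 * S i q.2 q'.2 := by
    simp only [dotProduct, mulVec, limScoreCov, Matrix.sum_apply, kroneckerMap_apply, Finset.mul_sum]
    refine Finset.sum_congr rfl fun q _ => Finset.sum_congr rfl fun q' _ => ?_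
    rw [Finset.sum_mul, Finset.mul_sum]
    exact Finset.sum_congr rfl fun i _ => by ring
  rw [hlim]
  have h1 := tendsto_finsetSum Finset.univ fun (q : (Fin a ⊕ Fin c) × Fin p) _ =>
    tendsto_finsetSum Finset.univ fun (q' : (Fin a ⊕ Fin c) × Fin p) _ =>
    (tendsto_finsetSum Finset.univ fun i _ =>
      (hD.groupGram i q.1 q'.1).mul (hE.cov_apply i q.2 q'.2)).const_mul (θ q * θ q')
  refine h1.congr fun t => ?_
  have hinv : (√(total (n t) : ℝ))⁻¹ * (√(total (n t) : ℝ))⁻¹ = (total (n t) : ℝ)⁻¹ := by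
    rw [← mul_inv, Real.mul_self_sqrt (by positivity)]
  have h2 : ∀ s : Subj (n t), ∫ ω, scoreTerm z (n t) θ s (e t ω s) ^ 2 ∂P t =
      ∑ q, ∑ q', θ q * θ q' * ((total (n t) : ℝ)⁻¹ * (row z s.1 s.2 q.1 * row z s.1 s.2 q'.1) *
        St t s.1 q.2 q'.2) := by
    intro s
    have h3 : ∀ ω, scoreTerm z (n t) θ s (e t ω s) ^ 2 = ∑ q, ∑ q', θ q * θ q' *
        ((total (n t) : ℝ)⁻¹ * (row z s.1 s.2 q.1 * row z s.1 s.2 q'.1)) *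
        (e t ω s q.2 * e t ω s q'.2) := by
      intro ω
      rw [scoreTerm, sq, Finset.sum_mul_sum]
      refine Finset.sum_congr rfl fun q _ => Finset.sum_congr rfl fun q' _ => ?_
      rw [← hinv]
      ring
    have hint : ∀ q q' : (Fin a ⊕ Fin c) × Fin p, Integrable (fun ω => θ q * θ q' *
        ((total (n t) : ℝ)⁻¹ * (row z s.1 s.2 q.1 * row z s.1 s.2 q'.1)) *
        (e t ω s q.2 * e t ω s q'.2)) (P t) := fun q q' =>
      ((hE.memLp t s q.2).integrable_mul (hE.memLp t s q'.2)).const_mul _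
    simp only [h3]
    rw [integral_finsetSum Finset.univ fun q _ => integrable_finsetSum Finset.univ fun q' _ =>
      hint q q']
    refine Finset.sum_congr rfl fun q _ => ?_
    rw [integral_finsetSum _ fun q' _ => hint q q']
    refine Finset.sum_congr rfl fun q' _ => ?_
    rw [integral_const_mul, hE.second]
    ring
  symm
  rw [Fintype.sum_congr _ _ h2, Finset.sum_comm]
  refine Finset.sum_congr rfl fun q _ => ?_
  rw [Finset.sum_comm]
  refine Finset.sum_congr rfl fun q' _ => ?_
  rw [← Finset.mul_sum, Fintype.sum_sigma]
  congr 1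
  refine Finset.sum_congr rfl fun i _ => ?_
  rw [Finset.mul_sum, Finset.sum_mul]

/-- **Central limit theorem** for the score. -/
theorem tendsto_charFun_score (hE : ErrorArray l n P e St S C)
    (hD : DesignLimit l z n κ m Ξ) (hpsd : (limScoreCov κ m Ξ S).PosSemidef)
    (θ : EuclideanSpace ℝ ((Fin a ⊕ Fin c) × Fin p)) :
    Tendsto (fun t => charFun ((P t).map fun ω => score z (n t) (e t ω)) θ) l
      (𝓝 (charFun (multivariateGaussian 0 (limScoreCov κ m Ξ S)) θ)) := by
  have h := tendsto_integral_exp_sum (l := l) (P := P)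
    (ξ := fun t s ω => scoreTerm z (n t) θ s (e t ω s))
    (fun t s => (measurable_scoreTerm z (n t) θ s).comp (hE.meas t s))
    (hE.iIndepFun_scoreTerm θ) (hE.integrable_scoreTerm_pow_four θ) (hE.integral_scoreTerm θ)
    (hE.tendsto_sum_integral_scoreTerm_sq hD θ) (hE.tendsto_sum_integral_scoreTerm_pow_four hD θ)
  rw [charFun_multivariateGaussian hpsd]
  have e1 : Complex.exp ((inner ℝ θ (0 : EuclideanSpace ℝ ((Fin a ⊕ Fin c) × Fin p)) : ℝ) *
      Complex.I - ((θ ⬝ᵥ (limScoreCov κ m Ξ S *ᵥ θ) : ℝ) : ℂ) / 2) =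
      Complex.exp (-((θ ⬝ᵥ (limScoreCov κ m Ξ S *ᵥ θ) : ℝ) : ℂ) / 2) := by
    congr 1
    simp
    ring
  rw [e1]
  refine h.congr fun t => ?_
  rw [charFun_apply, integral_map (hE.measurable_score t).aemeasurable (by fun_prop)]
  simp only [inner_score]

/-- The score has bounded second moments. -/
theorem exists_integral_score_sq_le (hE : ErrorArray l n P e St S C)
    (hD : DesignLimit l z n κ m Ξ) (q : (Fin a ⊕ Fin c) × Fin p) :
    (∀ t, MemLp (fun ω => score z (n t) (e t ω) q) 2 (P t)) ∧
      ∃ B, ∀ᶠ t in l, ∫ ω, score z (n t) (e t ω) q ^ 2 ∂P t ≤ B := by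
  classical
  have hs : ∀ t ω, score z (n t) (e t ω) q = ∑ s, scoreTerm z (n t) (Pi.single q 1) s (e t ω s) := by
    intro t ω
    have := inner_score z (n t) (e t ω) (EuclideanSpace.single q (1 : ℝ))
    rw [EuclideanSpace.inner_single_right] at this
    simpa using this
  have hL : ∀ t, MemLp (fun ω => score z (n t) (e t ω) q) 2 (P t) := by
    intro t
    simp only [hs]
    exact memLp_finsetSum _ fun s _ => hE.memLp_scoreTerm _ t s
  refine ⟨hL, Pi.single q 1 ⬝ᵥ (limScoreCov κ m Ξ S *ᵥ Pi.single q 1) + 1, ?_⟩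
  filter_upwards [(hE.tendsto_sum_integral_scoreTerm_sq hD (Pi.single q 1)).eventually_le_const
    (lt_add_one _)] with t ht
  refine le_trans (le_of_eq ?_) ht
  have h0 : ∫ ω, score z (n t) (e t ω) q ∂P t = 0 := by
    simp only [hs]
    rw [integral_finsetSum _ fun s _ => (hE.memLp_scoreTerm _ t s).integrable (by norm_num)]
    simp [hE.integral_scoreTerm]
  rw [← variance_of_integral_eq_zero (hL t).aestronglyMeasurable.aemeasurable h0]
  have hvar := IndepFun.variance_sum (s := Finset.univ)
    (X := fun s ω => scoreTerm z (n t) (Pi.single q 1) s (e t ω s))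
    (fun s _ => hE.memLp_scoreTerm _ t s)
    (fun i _ j _ hij => (hE.iIndepFun_scoreTerm (Pi.single q 1) t).indepFun hij)
  have e1 : (∑ s, fun ω => scoreTerm z (n t) (Pi.single q 1) s (e t ω s)) =
      fun ω => score z (n t) (e t ω) q := by
    ext ω
    simp [hs]
  rw [e1] at hvar
  rw [hvar]
  exact Finset.sum_congr rfl fun s _ => variance_of_integral_eq_zero
    ((hE.memLp_scoreTerm _ t s).aestronglyMeasurable.aemeasurable) (hE.integral_scoreTerm _ t s)

/-- The distribution functions of the MANCATS of a pure error array converge to that of the limiting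
quadratic form in a Gaussian vector. -/
theorem tendsto_measureReal_mancats_le [l.IsCountablyGenerated] (hE : ErrorArray l n P e St S C)
    (hD : DesignLimit l z n κ m Ξ) (hpsd : (limScoreCov κ m Ξ S).PosSemidef)
    (hSdiag : ∀ i k, 0 < S i k k) {T : Matrix (Fin a × Fin p) (Fin a × Fin p) ℝ}
    (hT : Tᵀ = T) (hTT : T * T = T) {M : Matrix _ _ ℝ}
    (hM : M = formMatrix T (limGram κ m Ξ)⁻¹ (diagonal fun ik => κ ik.1 * S ik.1 ik.2 ik.2))
    {F : ℝ → ℝ} (hF : Continuous F)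
    (hFq : ∀ x, F x = (multivariateGaussian 0 (limScoreCov κ m Ξ S)).real {v | v ⬝ᵥ (M *ᵥ v) ≤ x})
    (hatom : ∀ x, multivariateGaussian 0 (limScoreCov κ m Ξ S) {v | v ⬝ᵥ (M *ᵥ v) = x} = 0)
    (x : ℝ) :
    Tendsto (fun t => (P t).real {ω | mancats z (n t) T (e t ω) ≤ x}) l (𝓝 (F x)) ∧
      Tendsto (fun t => (P t).real {ω | x < mancats z (n t) T (e t ω)}) l (𝓝 (1 - F x)) := by
  have hq : Continuous fun v : EuclideanSpace ℝ ((Fin a ⊕ Fin c) × Fin p) =>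
      v.ofLp ⬝ᵥ (M *ᵥ v.ofLp) := by
    simp only [dotProduct, mulVec]
    fun_prop
  have hdpos : ∀ ik : Fin a × Fin p, 0 < κ ik.1 * S ik.1 ik.2 ik.2 := fun ik =>
    mul_pos (hD.pos _) (hSdiag _ _)
  refine tendsto_measureReal_le_of_sub
    (A := fun s : Σ t, Ω t => mancats z (n s.1) T (e s.1 s.2))
    (R := fun s : Σ t, Ω t => (score z (n s.1) (e s.1 s.2)).ofLp ⬝ᵥ
      (M *ᵥ (score z (n s.1) (e s.1 s.2)).ofLp))
    (fun t => hq.measurable.comp (hE.measurable_score t)) hF (fun x => ?_) ?_ x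
  · rw [hFq]
    exact tendsto_measureReal_le_of_charFun (fun t => hE.measurable_score t)
      (hE.tendsto_charFun_score hD hpsd) hq (hatom x)
  · choose hL B hB using hE.exists_integral_score_sq_le hD (p := p)
    have hform := tendsto_formMatrix hT hTT (hD.invGram.comp (tendsto_fst_whp (l := l) (P := P)))
      hdpos (hE.tendsto_diagEst hD)
    rw [← hM] at hform
    have h1 := tendsto_quadratic_sub_whp hform
      (V := fun s : Σ t, Ω t => (score z (n s.1) (e s.1 s.2)).ofLp) hL hB
    refine h1.congr' ?_
    have hpos : ∀ᶠ s in whp l P, ∀ ik,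
        0 < (total (n s.1) : ℝ) * diagEst z (n s.1) (e s.1 s.2) ik ik := by
      refine eventually_all.2 fun ik => ?_
      have := tendsto_pi_nhds.1 (tendsto_pi_nhds.1 (hE.tendsto_diagEst hD) ik) ik
      rw [diagonal_apply_eq] at this
      exact this.eventually_const_lt (hdpos ik)
    filter_upwards [hpos, tendsto_fst_whp.eventually hD.isUnit_det,
      tendsto_fst_whp.eventually hD.total_pos] with s h2 h3 h4
    rw [mancats_eq z (n s.1) hT hTT (e s.1 s.2) h4 h3 h2]
    rfl

end ErrorArray

/-! ### The limiting distribution function -/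

/-- Replacing the component of a standard Gaussian vector along a unit vector by an independent standard
normal variable does not change its law. -/
theorem map_prod_stdGaussian {E : Type*} [NormedAddCommGroup E] [InnerProductSpace ℝ E]
    [FiniteDimensional ℝ E] [MeasurableSpace E] [BorelSpace E] {v : E} (hv : ‖v‖ = 1) :
    ((stdGaussian E).prod (gaussianReal 0 1)).map
      (fun gs : E × ℝ => gs.2 • v + (gs.1 - inner ℝ v gs.1 • v)) = stdGaussian E := by
  have := FiniteDimensional.proper ℝ E
  have hcont : Continuous fun gs : E × ℝ => gs.2 • v + (gs.1 - inner ℝ v gs.1 • v) := by fun_prop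
  have hm := hcont.measurable
  have : IsProbabilityMeasure (((stdGaussian E).prod (gaussianReal 0 1)).map
      (fun gs : E × ℝ => gs.2 • v + (gs.1 - inner ℝ v gs.1 • v))) :=
    Measure.isProbabilityMeasure_map hm.aemeasurable
  refine Measure.ext_of_charFun ?_
  ext θ
  rw [charFun_apply, integral_map hm.aemeasurable (by fun_prop)]
  have hin : ∀ gs : E × ℝ, Complex.exp
      ((inner ℝ (gs.2 • v + (gs.1 - inner ℝ v gs.1 • v)) θ : ℝ) * Complex.I) =
      Complex.exp ((inner ℝ gs.1 (θ - inner ℝ v θ • v) : ℝ) * Complex.I) *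
        Complex.exp (((inner ℝ v θ : ℝ) : ℂ) * (gs.2 : ℂ) * Complex.I) := by
    intro gs
    rw [← Complex.exp_add, ← add_mul]
    congr 2
    norm_cast
    rw [inner_add_left, inner_sub_left, inner_smul_left, inner_smul_left, inner_sub_right,
      inner_smul_right, real_inner_comm v gs.1]
    simp
    ring
  simp only [hin]
  rw [integral_prod_mul (μ := stdGaussian E) (ν := gaussianReal 0 1)
    (fun g : E => Complex.exp ((inner ℝ g (θ - inner ℝ v θ • v) : ℝ) * Complex.I))
    (fun s : ℝ => Complex.exp (((inner ℝ v θ : ℝ) : ℂ) * (s : ℂ) * Complex.I)),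
    ← charFun_apply, ← charFun_apply_real, charFun_stdGaussian, charFun_stdGaussian,
    charFun_gaussianReal, ← Complex.exp_add]
  congr 1
  have hn : ‖θ - inner ℝ v θ • v‖ ^ 2 = ‖θ‖ ^ 2 - (inner ℝ v θ) ^ 2 := by
    rw [norm_sub_sq_real, inner_smul_right, norm_smul, hv, real_inner_comm v θ, mul_one,
      Real.norm_eq_abs, sq_abs]
    ring
  have hn' : ((‖θ - inner ℝ v θ • v‖ : ℝ) : ℂ) ^ 2 =
      ((‖θ‖ : ℝ) : ℂ) ^ 2 - ((inner ℝ v θ : ℝ) : ℂ) ^ 2 := by exact_mod_cast hn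
  rw [hn']
  simp
  ring

/-- A nonvanishing quadratic form in a standard Gaussian vector has no atoms: along a direction in which
the form does not vanish, it is a quadratic polynomial. -/
theorem stdGaussian_quadratic_eq_null {γ : Type*} [Fintype γ] (B : Matrix γ γ ℝ) {g₀ : γ → ℝ}
    (h0 : g₀ ⬝ᵥ (B *ᵥ g₀) ≠ 0) (x : ℝ) :
    stdGaussian (EuclideanSpace ℝ γ) {g | g.ofLp ⬝ᵥ (B *ᵥ g.ofLp) = x} = 0 := by
  set w : EuclideanSpace ℝ γ := WithLp.toLp 2 g₀ with hw
  have hw0 : w ≠ 0 := by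
    intro h
    apply h0
    have : g₀ = 0 := by simpa [hw] using congrArg WithLp.ofLp h
    simp [this]
  have hwn : ‖w‖ ≠ 0 := norm_ne_zero_iff.2 hw0
  set v : EuclideanSpace ℝ γ := ‖w‖⁻¹ • w with hv
  have hv1 : ‖v‖ = 1 := by
    rw [hv, norm_smul, norm_inv, norm_norm, inv_mul_cancel₀ hwn]
  have hvq : v.ofLp ⬝ᵥ (B *ᵥ v.ofLp) ≠ 0 := by
    rw [hv, WithLp.ofLp_smul, mulVec_smul, smul_dotProduct, dotProduct_smul]
    simp only [smul_eq_mul]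
    exact mul_ne_zero (inv_ne_zero hwn) (mul_ne_zero (inv_ne_zero hwn) h0)
  have hq : Continuous fun g : EuclideanSpace ℝ γ => g.ofLp ⬝ᵥ (B *ᵥ g.ofLp) := by
    simp only [dotProduct, mulVec]
    fun_prop
  have hcont : Continuous fun gs : EuclideanSpace ℝ γ × ℝ =>
      gs.2 • v + (gs.1 - inner ℝ v gs.1 • v) := by fun_prop
  have hS : MeasurableSet {g : EuclideanSpace ℝ γ | g.ofLp ⬝ᵥ (B *ᵥ g.ofLp) = x} :=
    (isClosed_eq hq continuous_const).measurableSet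
  rw [← map_prod_stdGaussian hv1, Measure.map_apply hcont.measurable hS,
    Measure.measure_prod_null (hcont.measurable hS)]
  refine ae_of_all _ fun g => ?_
  set u : EuclideanSpace ℝ γ := g - inner ℝ v g • v
  set A := v.ofLp ⬝ᵥ (B *ᵥ v.ofLp)
  set b := v.ofLp ⬝ᵥ (B *ᵥ u.ofLp) + u.ofLp ⬝ᵥ (B *ᵥ v.ofLp)
  have hexp : ∀ s : ℝ, (s • v + u).ofLp ⬝ᵥ (B *ᵥ (s • v + u).ofLp) =
      A * s ^ 2 + b * s + u.ofLp ⬝ᵥ (B *ᵥ u.ofLp) := by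
    intro s
    simp only [WithLp.ofLp_add, WithLp.ofLp_smul, mulVec_add, mulVec_smul, dotProduct_add,
      add_dotProduct, smul_dotProduct, dotProduct_smul, smul_eq_mul, A, b]
    ring
  have hfin : {s : ℝ | A * s ^ 2 + b * s + u.ofLp ⬝ᵥ (B *ᵥ u.ofLp) = x}.Finite := by
    by_cases hex : ∃ s₁, A * s₁ ^ 2 + b * s₁ + u.ofLp ⬝ᵥ (B *ᵥ u.ofLp) = x
    · obtain ⟨s₁, hs₁⟩ := hex
      refine (Set.toFinite {s₁, -b / A - s₁}).subset fun s hs => ?_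
      have hs' : A * s ^ 2 + b * s + u.ofLp ⬝ᵥ (B *ᵥ u.ofLp) = x := hs
      have hprod : (s - s₁) * (A * (s + s₁) + b) = 0 := by linear_combination hs' - hs₁
      rcases mul_eq_zero.1 hprod with h | h
      · left; linarith
      · right
        rw [Set.mem_singleton_iff]
        field_simp
        linarith
    · refine Set.Finite.subset Set.finite_empty fun s hs => hex ⟨s, hs⟩
  have hset : Prod.mk g ⁻¹' ((fun gs : EuclideanSpace ℝ γ × ℝ =>
      gs.2 • v + (gs.1 - inner ℝ v gs.1 • v)) ⁻¹' {g | g.ofLp ⬝ᵥ (B *ᵥ g.ofLp) = x}) =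
      {s : ℝ | A * s ^ 2 + b * s + u.ofLp ⬝ᵥ (B *ᵥ u.ofLp) = x} := by
    ext s
    simp only [Set.mem_preimage, Set.mem_ofPred_eq]
    rw [← hexp]
  simp only [hset, Pi.zero_apply]
  have := nullSingletonClass_gaussianReal (μ := 0) (v := 1) one_ne_zero
  exact hfin.measure_zero _

open scoped MatrixOrder in
/-- A quadratic form that does not vanish on the range of the covariance has no atoms under the Gaussian
measure. -/
theorem multivariateGaussian_quadratic_eq_null {γ δ : Type*} [Fintype γ] [DecidableEq γ] [Fintype δ]
    {Ψ : Matrix γ γ ℝ} (hΨ : Ψ.PosSemidef) {Q : Matrix δ γ ℝ} {M : Matrix δ δ ℝ}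
    (hM : ∀ y, Q *ᵥ y ≠ 0 → (Q *ᵥ y) ⬝ᵥ (M *ᵥ (Q *ᵥ y)) ≠ 0) (hQ : Q * Ψ ≠ 0) (x : ℝ) :
    multivariateGaussian 0 Ψ {v | v.ofLp ⬝ᵥ ((Qᵀ * M * Q) *ᵥ v.ofLp) = x} = 0 := by
  set R := CFC.sqrt Ψ with hR
  have hRR : R * R = Ψ := CFC.sqrt_mul_sqrt_self Ψ hΨ.nonneg
  obtain ⟨g₀, hg₀⟩ : ∃ g₀, Q *ᵥ (R *ᵥ g₀) ≠ 0 := by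
    by_contra hcon
    push Not at hcon
    apply hQ
    have : Q * R = 0 := by
      ext i j
      have := congrFun (hcon (Pi.single j 1)) i
      rw [mulVec_mulVec] at this
      simpa using this
    rw [← hRR, ← Matrix.mul_assoc, this, Matrix.zero_mul]
  have hq : Continuous fun g : EuclideanSpace ℝ γ => g.ofLp ⬝ᵥ ((Qᵀ * M * Q) *ᵥ g.ofLp) := by
    simp only [dotProduct, mulVec]
    fun_prop
  rw [multivariateGaussian, Measure.map_apply (by fun_prop)
    (isClosed_eq hq continuous_const).measurableSet]
  refine measure_mono_null (fun g hg => ?_)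
    (stdGaussian_quadratic_eq_null (Rᵀ * (Qᵀ * M * Q) * R) (g₀ := g₀) ?_ x)
  · rw [Set.mem_preimage, Set.mem_ofPred_eq, zero_add, ofLp_toEuclideanCLM] at hg
    rw [Set.mem_ofPred_eq, dotProduct_transpose_mul_mul_mulVec]
    exact hg
  · rw [dotProduct_transpose_mul_mul_mulVec, dotProduct_transpose_mul_mul_mulVec]
    exact hM _ hg₀

/-- The distribution function of a real variable without atoms is a continuous distribution
function. -/
theorem continuous_measureReal_le {E : Type*} [MeasurableSpace E] {μ : Measure E}
    [IsProbabilityMeasure μ] {q : E → ℝ} (hq : Measurable q) (h0 : ∀ x, μ {v | q v = x} = 0) :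
    Continuous (fun x => μ.real {v | q v ≤ x}) ∧ Monotone (fun x => μ.real {v | q v ≤ x}) ∧
      Tendsto (fun x => μ.real {v | q v ≤ x}) atBot (𝓝 0) ∧
      Tendsto (fun x => μ.real {v | q v ≤ x}) atTop (𝓝 1) := by
  have : IsProbabilityMeasure (μ.map q) := Measure.isProbabilityMeasure_map hq.aemeasurable
  have hF : (fun x => μ.real {v | q v ≤ x}) = cdf (μ.map q) := by
    ext x
    rw [cdf_eq_real, map_measureReal_apply hq measurableSet_Iic]
    rfl
  rw [hF]
  refine ⟨continuous_iff_continuousAt.2 fun x => ?_, monotone_cdf _, tendsto_cdf_atBot _,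
    tendsto_cdf_atTop _⟩
  have h1 := (cdf (μ.map q)).measure_singleton x
  rw [measure_cdf, Measure.map_apply hq (measurableSet_singleton x)] at h1
  have h2 : ENNReal.ofReal (cdf (μ.map q) x - Function.leftLim (cdf (μ.map q)) x) = 0 := by
    rw [← h1]
    exact h0 x
  rw [ENNReal.ofReal_eq_zero] at h2
  rw [(monotone_cdf _).continuousAt_iff_leftLim_eq_rightLim, StieltjesFunction.rightLim_eq]
  exact le_antisymm ((monotone_cdf _).leftLim_le le_rfl) (by linarith)

theorem limGroupGram_posSemidef {ι : Type*} {a c : ℕ} {l : Filter ι} {z : Fin a → ℕ → Fin c → ℝ}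
    {n : ι → Fin a → ℕ} {κ : Fin a → ℝ} {m : Fin a → Fin c → ℝ}
    {Ξ : Fin a → Matrix (Fin c) (Fin c) ℝ} (h : DesignLimit l z n κ m Ξ) (i : Fin a) :
    (limGroupGram κ m Ξ i).PosSemidef := by
  refine PosSemidef.smul ?_ (inv_pos.2 (h.pos i)).le
  refine PosSemidef.of_dotProduct_mulVec_nonneg ?_ fun x => ?_
  · ext v w
    rw [conjTranspose_apply, star_trivial]
    refine tendsto_nhds_unique (h.row_second i w v) ((h.row_second i v w).congr fun s => ?_)
    congr 1
    exact Finset.sum_congr rfl fun j _ => mul_comm _ _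
  · rw [star_trivial]
    have h1 := tendsto_finsetSum Finset.univ fun v _ => tendsto_finsetSum Finset.univ fun w _ =>
      (h.row_second i v w).const_mul (x v * x w)
    have e1 : x ⬝ᵥ (fromBlocks (vecMulVec (Pi.single i 1) (Pi.single i 1))
        (vecMulVec (Pi.single i 1) (m i)) (vecMulVec (m i) (Pi.single i 1)) (Ξ i) *ᵥ x) =
        ∑ v, ∑ w, x v * x w * fromBlocks (vecMulVec (Pi.single i 1) (Pi.single i 1))
        (vecMulVec (Pi.single i 1) (m i)) (vecMulVec (m i) (Pi.single i 1)) (Ξ i) v w := by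
      simp only [dotProduct, mulVec, Finset.mul_sum]
      exact Finset.sum_congr rfl fun v _ => Finset.sum_congr rfl fun w _ => by ring
    rw [e1]
    refine ge_of_tendsto' h1 fun s => ?_
    have e2 : ∑ v, ∑ w, x v * x w * ((s : ℝ)⁻¹ * ∑ j ∈ Finset.range s, row z i j v * row z i j w) =
        (s : ℝ)⁻¹ * ∑ j ∈ Finset.range s, (∑ v, x v * row z i j v) ^ 2 := by
      have e3 : ∀ j, (∑ v, x v * row z i j v) ^ 2 =
          ∑ v, ∑ w, x v * x w * (row z i j v * row z i j w) := fun j => by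
        rw [sq, Finset.sum_mul_sum]
        exact Finset.sum_congr rfl fun v _ => Finset.sum_congr rfl fun w _ => by ring
      simp only [e3]
      rw [Finset.sum_comm (s := Finset.range s), Finset.mul_sum]
      refine Finset.sum_congr rfl fun v _ => ?_
      rw [Finset.sum_comm (s := Finset.range s), Finset.mul_sum]
      refine Finset.sum_congr rfl fun w _ => ?_
      rw [← Finset.mul_sum]
      ring
    rw [e2]
    positivity

theorem limScoreCov_posSemidef {ι : Type*} {a c p : ℕ} {l : Filter ι} {z : Fin a → ℕ → Fin c → ℝ}
    {n : ι → Fin a → ℕ} {κ : Fin a → ℝ} {m : Fin a → Fin c → ℝ}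
    {Ξ : Fin a → Matrix (Fin c) (Fin c) ℝ} (h : DesignLimit l z n κ m Ξ)
    {S : Fin a → Matrix (Fin p) (Fin p) ℝ} (hS : ∀ i, (S i).PosSemidef) :
    (limScoreCov κ m Ξ S).PosSemidef := by
  refine Matrix.posSemidef_sum _ fun i _ => ?_
  exact (limGroupGram_posSemidef h i).kronecker (hS i)

theorem limCovMeans_eq {ι : Type*} {a c p : ℕ} {l : Filter ι} {z : Fin a → ℕ → Fin c → ℝ}
    {n : ι → Fin a → ℕ} {κ : Fin a → ℝ} {m : Fin a → Fin c → ℝ}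
    {Ξ : Fin a → Matrix (Fin c) (Fin c) ℝ} (h : DesignLimit l z n κ m Ξ)
    (S : Fin a → Matrix (Fin p) (Fin p) ℝ) :
    limCovMeans κ m Ξ S =
      meanRows p (limGram κ m Ξ)⁻¹ * limScoreCov κ m Ξ S * (meanRows p (limGram κ m Ξ)⁻¹)ᵀ := by
  have hsym : ((limGram κ m Ξ)⁻¹)ᵀ = (limGram κ m Ξ)⁻¹ := by
    rw [transpose_nonsing_inv]
    congr 1
    have : (limGram κ m Ξ).PosSemidef :=
      Matrix.posSemidef_sum _ fun i _ => limGroupGram_posSemidef h i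
    simpa [conjTranspose_eq_transpose_of_trivial] using this.isHermitian.eq
  have hk : ((limGram κ m Ξ)⁻¹ ⊗ₖ (1 : Matrix (Fin p) (Fin p) ℝ))ᵀ =
      (limGram κ m Ξ)⁻¹ ⊗ₖ (1 : Matrix (Fin p) (Fin p) ℝ) := by
    rw [← kroneckerMap_transpose, hsym, transpose_one]
  have ht : (meanRows p (limGram κ m Ξ)⁻¹)ᵀ =
      ((limGram κ m Ξ)⁻¹ ⊗ₖ (1 : Matrix (Fin p) (Fin p) ℝ)).submatrix id (Prod.map Sum.inl id) := by
    rw [meanRows, transpose_submatrix, hk]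
  rw [ht, limCovMeans, limCov, meanRows]
  rfl

/-- The limiting null distribution of the MANCATS has no atoms. -/
theorem limit_quadratic_eq_null {ι : Type*} {a c p : ℕ} {l : Filter ι}
    {z : Fin a → ℕ → Fin c → ℝ} {n : ι → Fin a → ℕ} {κ : Fin a → ℝ} {m : Fin a → Fin c → ℝ}
    {Ξ : Fin a → Matrix (Fin c) (Fin c) ℝ} (h : DesignLimit l z n κ m Ξ)
    {S : Fin a → Matrix (Fin p) (Fin p) ℝ} (hS : ∀ i, (S i).PosSemidef)
    (hSdiag : ∀ i k, 0 < S i k k) {T : Matrix (Fin a × Fin p) (Fin a × Fin p) ℝ}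
    (hT : Tᵀ = T) (hTT : T * T = T) (hnondeg : T * limCovMeans κ m Ξ S * T ≠ 0) (x : ℝ) :
    multivariateGaussian 0 (limScoreCov κ m Ξ S) {v | v.ofLp ⬝ᵥ
      (formMatrix T (limGram κ m Ξ)⁻¹ (diagonal fun ik => κ ik.1 * S ik.1 ik.2 ik.2) *ᵥ v.ofLp) =
        x} = 0 := by
  set d : Fin a × Fin p → ℝ := fun ik => κ ik.1 * S ik.1 ik.2 ik.2
  have hd : ∀ ik, 0 < d ik := fun ik => mul_pos (h.pos _) (hSdiag _ _)
  set L := meanRows p (limGram κ m Ξ)⁻¹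
  have hform : formMatrix T (limGram κ m Ξ)⁻¹ (diagonal d) =
      (T * L)ᵀ * (T * (compression T (diagonal d))⁻¹ * T) * (T * L) := by
    rw [formMatrix, transpose_mul, hT]
    simp only [Matrix.mul_assoc]
    rw [← Matrix.mul_assoc T T, ← Matrix.mul_assoc T T, hTT]
  rw [hform]
  refine multivariateGaussian_quadratic_eq_null (limScoreCov_posSemidef h hS) (fun y hy => ?_) ?_ x
  · refine (dotProduct_compression_inv_pos hT hTT hd ?_).ne'
    rw [mulVec_mulVec, ← Matrix.mul_assoc, hTT]
    exact hy
  · intro h0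
    apply hnondeg
    rw [limCovMeans_eq h]
    calc T * (L * limScoreCov κ m Ξ S * Lᵀ) * T = (T * L * limScoreCov κ m Ξ S) * Lᵀ * T := by
          simp only [Matrix.mul_assoc]
      _ = 0 := by rw [h0]; simp

/-! ### Invariance under the regression coefficients -/

section Invariance

variable {a c p : ℕ} {z : Fin a → ℕ → Fin c → ℝ} {n : Fin a → ℕ}

theorem ols_modelData (hdet : IsUnit ((design z n)ᵀ * design z n).det)
    (B : Matrix (Fin a ⊕ Fin c) (Fin p) ℝ) (e : Fin a → ℕ → Fin p → ℝ) :
    ols z n (modelData z n B e) = B + ols z n fun s => e s.1 s.2 := by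
  have h : Matrix.of (modelData z n B e) = design z n * B + Matrix.of fun s : Subj n => e s.1 s.2 := by
    ext s k
    rfl
  rw [ols, h, Matrix.mul_add, Matrix.mul_assoc _ _ (design z n * B), ← Matrix.mul_assoc _ _ B,
    ← Matrix.mul_assoc _ _ B, nonsing_inv_mul _ hdet, Matrix.one_mul]
  rfl

theorem covEst_modelData (hdet : IsUnit ((design z n)ᵀ * design z n).det)
    (B : Matrix (Fin a ⊕ Fin c) (Fin p) ℝ) (e : Fin a → ℕ → Fin p → ℝ) :
    covEst z n (modelData z n B e) = covEst z n fun s => e s.1 s.2 := by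
  have h : resid z n (modelData z n B e) = resid z n fun s => e s.1 s.2 := by
    ext s k
    rw [resid, resid, ols_modelData hdet, Matrix.mul_add, Matrix.add_apply, modelData]
    ring
  ext i : 1
  rw [covEst, covEst, h]

theorem bootCDF_modelData (hdet : IsUnit ((design z n)ᵀ * design z n).det)
    (T : Matrix (Fin a × Fin p) (Fin a × Fin p) ℝ)
    (B : Matrix (Fin a ⊕ Fin c) (Fin p) ℝ) (e : Fin a → ℕ → Fin p → ℝ) :
    bootCDF z n T (modelData z n B e) = bootCDF z n T fun s => e s.1 s.2 := by
  ext x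
  rw [bootCDF, bootCDF, bootMeasure, bootMeasure, covEst_modelData hdet]

theorem mancats_modelData (hdet : IsUnit ((design z n)ᵀ * design z n).det)
    {T : Matrix (Fin a × Fin p) (Fin a × Fin p) ℝ}
    {B : Matrix (Fin a ⊕ Fin c) (Fin p) ℝ} (hB : T *ᵥ adjMeans B = 0)
    (e : Fin a → ℕ → Fin p → ℝ) :
    mancats z n T (modelData z n B e) = mancats z n T fun s => e s.1 s.2 := by
  have hdiag : diagEst z n (modelData z n B e) = diagEst z n fun s => e s.1 s.2 := by
    rw [diagEst, diagEst, covEst_modelData hdet]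
  have hmean : adjMeans (ols z n (modelData z n B e)) =
      adjMeans B + adjMeans (ols z n fun s => e s.1 s.2) := by
    rw [ols_modelData hdet]
    rfl
  rw [mancats, mancats, hdiag, dotProduct_transpose_mul_mul_mulVec,
    dotProduct_transpose_mul_mul_mulVec, hmean, mulVec_add, hB, zero_add]

theorem covEst_posSemidef (Y : Subj n → Fin p → ℝ) (hdof : ∀ i, 0 < (n i : ℝ) - c - 1)
    (i : Fin a) : (covEst z n Y i).PosSemidef := by
  refine PosSemidef.smul (Matrix.posSemidef_sum _ fun j _ => ?_) (inv_pos.2 (hdof i)).le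
  simpa using posSemidef_vecMulVec_self_star (resid z n Y ⟨i, j⟩)

end Invariance

theorem DesignLimit.comp {ι ι' : Type*} {a c : ℕ} {l : Filter ι} {l' : Filter ι'}
    {z : Fin a → ℕ → Fin c → ℝ} {n : ι → Fin a → ℕ} {κ : Fin a → ℝ} {m : Fin a → Fin c → ℝ}
    {Ξ : Fin a → Matrix (Fin c) (Fin c) ℝ} (h : DesignLimit l z n κ m Ξ) {u : ι' → ι}
    (hu : Tendsto u l' l) : DesignLimit l' z (fun t => n (u t)) κ m Ξ where
  total_atTop := h.total_atTop.comp hu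
  pos := h.pos
  size i := (h.size i).comp hu
  det_ne_zero := h.det_ne_zero
  first := h.first
  second := h.second

/-! ### The bootstrap sample as an error array -/

theorem integral_pow_four_gaussianReal (v : NNReal) :
    ∫ x, x ^ 4 ∂gaussianReal 0 v = (v : ℝ) ^ 2 * ∫ x, x ^ 4 ∂gaussianReal 0 1 := by
  have h := gaussianReal_map_const_mul (μ := 0) (v := 1) (√(v : ℝ))
  have hv : (NNReal.mk (√(v : ℝ) ^ 2) (sq_nonneg _) * 1 : NNReal) = v := by
    ext
    simp
  rw [mul_zero, hv] at h
  rw [← h, integral_map (by fun_prop) (by fun_prop), ← integral_const_mul]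
  congr 1
  ext x
  rw [mul_pow, show 4 = 2 * 2 by norm_num, pow_mul (√(v : ℝ)), Real.sq_sqrt v.coe_nonneg]

theorem integrable_pow_four_gaussianReal (v : NNReal) :
    Integrable (fun x : ℝ => x ^ 4) (gaussianReal 0 v) := by
  have h := (memLp_id_gaussianReal (μ := 0) (v := v) 4).integrable_norm_pow (p := 4) (by norm_num)
  refine h.congr (ae_of_all _ fun x => ?_)
  simp [Even.pow_abs (show Even 4 by decide)]

theorem measurePreserving_bootstrap_apply {J : Type*} [Fintype J] {p : ℕ}
    {Vs : J → Matrix (Fin p) (Fin p) ℝ} (hVs : ∀ j, (Vs j).PosSemidef) (j : J) (k : Fin p) :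
    MeasurePreserving (fun y : J → EuclideanSpace ℝ (Fin p) => y j k)
      (Measure.pi fun j => multivariateGaussian 0 (Vs j))
      (gaussianReal 0 (Vs j k k).toNNReal) :=
  (measurePreserving_eval_multivariateGaussian (μ := 0) (hVs j) (i := k)).comp
    (measurePreserving_eval _ j)

theorem integral_comp_measurePreserving {X Y : Type*} [MeasurableSpace X] [MeasurableSpace Y]
    {μ : Measure X} {ν : Measure Y} {f : X → Y} (h : MeasurePreserving f μ ν) {g : Y → ℝ}
    (hg : Measurable g) : ∫ x, g (f x) ∂μ = ∫ y, g y ∂ν := by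
  rw [← h.map_eq, integral_map h.measurable.aemeasurable hg.aestronglyMeasurable]

/-- The parametric bootstrap, indexed by pairs of a sample size index and a tuple of covariance matrices
near the true ones, is an error array. Convergence along the product filter is convergence
uniformly over covariance matrices close to the true ones. -/
theorem errorArray_bootstrap {a p : ℕ} (n : ℕ → Fin a → ℕ)
    {S : Fin a → Matrix (Fin p) (Fin p) ℝ} (hS : ∀ i, (S i).PosSemidef) :
    ∃ C, ErrorArray
      (atTop ×ˢ 𝓝 (⟨S, hS⟩ : {Vs : Fin a → Matrix (Fin p) (Fin p) ℝ // ∀ i, (Vs i).PosSemidef}))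
      (fun τ => n τ.1)
      (fun τ => Measure.pi fun s : Subj (n τ.1) => multivariateGaussian 0 (τ.2.1 s.1))
      (fun _ y s k => y s k) (fun τ => τ.2.1) S C := by
  have hlim : Tendsto (fun τ : ℕ × {Vs : Fin a → Matrix (Fin p) (Fin p) ℝ //
      ∀ i, (Vs i).PosSemidef} => τ.2.1) (atTop ×ˢ 𝓝 ⟨S, hS⟩) (𝓝 S) :=
    (continuous_subtype_val.tendsto (⟨S, hS⟩ : {Vs : Fin a → Matrix (Fin p) (Fin p) ℝ //
      ∀ i, (Vs i).PosSemidef})).comp tendsto_snd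
  set K := ∫ x, x ^ 4 ∂gaussianReal 0 1
  have hK : 0 ≤ K := integral_nonneg fun x => by positivity
  set L : ℝ := ∑ i, ∑ k, (S i k k + 1)
  refine ⟨L ^ 2 * K, ?_, ?_, ?_, ?_, ?_, ?_, hlim⟩
  · intro τ s
    fun_prop
  · intro τ
    exact iIndepFun_pi (X := fun (_ : Subj (n τ.1)) (x : EuclideanSpace ℝ (Fin p)) => x.ofLp)
      fun s => by fun_prop
  · intro τ s k
    have := integral_comp_measurePreserving (measurePreserving_bootstrap_apply
      (fun s : Subj (n τ.1) => τ.2.2 s.1) s k) measurable_id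
    simpa using this
  · intro τ s k k'
    have hev := measurePreserving_eval (fun s : Subj (n τ.1) => multivariateGaussian 0 (τ.2.1 s.1)) s
    have h1 := integral_comp_measurePreserving hev
      (g := fun x : EuclideanSpace ℝ (Fin p) => x k * x k') (by fun_prop)
    rw [h1, ← covariance_eval_multivariateGaussian (μ := 0) (τ.2.2 s.1) k k']
    have hm : ∀ k, MemLp (fun x : EuclideanSpace ℝ (Fin p) => x k) 2
        (multivariateGaussian 0 (τ.2.1 s.1)) := fun k =>
      (memLp_id_gaussianReal 2).comp_measurePreserving
        (measurePreserving_eval_multivariateGaussian (μ := 0) (τ.2.2 s.1) (i := k))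
    have hmean : ∀ k, ∫ x : EuclideanSpace ℝ (Fin p), x k ∂multivariateGaussian 0 (τ.2.1 s.1) = 0 :=
      fun k => by
        have := integral_comp_measurePreserving
          (measurePreserving_eval_multivariateGaussian (μ := 0) (τ.2.2 s.1) (i := k)) measurable_id
        simpa using this
    rw [covariance_eq_sub (hm k) (hm k'), hmean, hmean, zero_mul, sub_zero]
    rfl
  · intro τ s k
    exact (measurePreserving_bootstrap_apply (fun s : Subj (n τ.1) => τ.2.2 s.1) s
      k).integrable_comp_of_integrable (integrable_pow_four_gaussianReal _)
  · have hev : ∀ᶠ τ in (atTop : Filter ℕ) ×ˢ 𝓝 (⟨S, hS⟩ : {Vs : Fin a → Matrix (Fin p) (Fin p) ℝ //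
        ∀ i, (Vs i).PosSemidef}), ∀ i k, τ.2.1 i k k < S i k k + 1 := by
      refine eventually_all.2 fun i => eventually_all.2 fun k => ?_
      have := tendsto_pi_nhds.1 (tendsto_pi_nhds.1 (tendsto_pi_nhds.1 hlim i) k) k
      exact this.eventually_lt_const (lt_add_one _)
    filter_upwards [hev] with τ hτ s k
    have h0 : ∀ i k, 0 ≤ S i k k + 1 := fun i k => by
      have := (hS i).diag_nonneg (i := k)
      linarith
    have hle : S s.1 k k + 1 ≤ L :=
      (Finset.single_le_sum (f := fun k => S s.1 k k + 1) (fun k _ => h0 s.1 k)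
        (Finset.mem_univ k)).trans
      (Finset.single_le_sum (f := fun i => ∑ k, (S i k k + 1))
        (fun i _ => Finset.sum_nonneg fun k _ => h0 i k) (Finset.mem_univ s.1))
    have h1 := integral_comp_measurePreserving (measurePreserving_bootstrap_apply
      (fun s : Subj (n τ.1) => τ.2.2 s.1) s k) (g := fun x : ℝ => x ^ 4) (by fun_prop)
    rw [h1, integral_pow_four_gaussianReal]
    refine mul_le_mul_of_nonneg_right ?_ hK
    have hnn := (τ.2.2 s.1).diag_nonneg (i := k)
    rw [Real.coe_toNNReal _ hnn]
    have := hτ s.1 k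
    gcongr
    linarith

/-! ### The conditional quantile -/

/-- A function uniformly close to a distribution function `F` has its quantiles between those of
`F` at slightly shifted levels. -/
theorem sInf_quantile_mem_Icc {F G : ℝ → ℝ} (hF : Monotone F) {δ q x₀ x₁ : ℝ}
    (hδ : 0 < δ) (hG : ∀ x, |G x - F x| < δ) (h0 : F x₀ = q - 2 * δ) (h1 : F x₁ = q + 2 * δ) :
    sInf {x | q ≤ G x} ∈ Set.Icc x₀ x₁ := by
  have hmem : x₁ ∈ {x | q ≤ G x} := by
    have := (abs_lt.1 (hG x₁)).1
    rw [Set.mem_ofPred_eq]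
    linarith
  have hlow : ∀ x ∈ {x | q ≤ G x}, x₀ ≤ x := by
    intro x hx
    rw [Set.mem_ofPred_eq] at hx
    by_contra hcon
    have h2 := hF (not_le.1 hcon).le
    have h3 := (abs_lt.1 (hG x)).2
    linarith
  exact ⟨le_csInf ⟨x₁, hmem⟩ hlow, csInf_le ⟨x₀, hlow⟩ hmem⟩

/-! ### Validity of the bootstrap -/

/-- Uniform convergence in probability of the bootstrap distribution function, for data consisting of
pure errors. Uniformity over covariance matrices near the true ones (`errorArray_bootstrap`) is
combined with the consistency of the covariance estimators. -/
theorem eventually_whp_bootCDF {a c p : ℕ} {Ω : Type*} [MeasurableSpace Ω] {P : Measure Ω}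
    [IsProbabilityMeasure P] {z : Fin a → ℕ → Fin c → ℝ} {n : ℕ → Fin a → ℕ} {κ : Fin a → ℝ}
    {m : Fin a → Fin c → ℝ} {Ξ : Fin a → Matrix (Fin c) (Fin c) ℝ}
    (hD : DesignLimit atTop z n κ m Ξ) {S : Fin a → Matrix (Fin p) (Fin p) ℝ}
    (hS : ∀ i, (S i).PosSemidef) (hSdiag : ∀ i k, 0 < S i k k)
    {T : Matrix (Fin a × Fin p) (Fin a × Fin p) ℝ} (hT : Tᵀ = T) (hTT : T * T = T)
    {M : Matrix _ _ ℝ}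
    (hM : M = formMatrix T (limGram κ m Ξ)⁻¹ (diagonal fun ik => κ ik.1 * S ik.1 ik.2 ik.2))
    {F : ℝ → ℝ} (hF : Continuous F) (hFmono : Monotone F) (hbot : Tendsto F atBot (𝓝 0))
    (htop : Tendsto F atTop (𝓝 1))
    (hFq : ∀ x, F x = (multivariateGaussian 0 (limScoreCov κ m Ξ S)).real {v | v ⬝ᵥ (M *ᵥ v) ≤ x})
    (hatom : ∀ x, multivariateGaussian 0 (limScoreCov κ m Ξ S) {v | v ⬝ᵥ (M *ᵥ v) = x} = 0)
    {e : ∀ t, Ω → Subj (n t) → Fin p → ℝ} {C : ℝ}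
    (hE : ErrorArray atTop n (fun _ => P) e (fun _ => S) S C) {δ : ℝ} (hδ : 0 < δ) :
    ∀ᶠ s : Σ _ : ℕ, Ω in whp atTop (fun _ => P),
      ∀ x, |bootCDF z (n s.1) T (e s.1 s.2) x - F x| < δ := by
  classical
  obtain ⟨C', hB⟩ := errorArray_bootstrap n hS
  have hD' : DesignLimit (atTop ×ˢ 𝓝 (⟨S, hS⟩ : {Vs : Fin a → Matrix (Fin p) (Fin p) ℝ //
      ∀ i, (Vs i).PosSemidef})) z (fun τ => n τ.1) κ m Ξ := hD.comp tendsto_fst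
  have : (𝓝 (⟨S, hS⟩ : {Vs : Fin a → Matrix (Fin p) (Fin p) ℝ //
      ∀ i, (Vs i).PosSemidef})).IsCountablyGenerated := by
    have : FirstCountableTopology (Fin a → Matrix (Fin p) (Fin p) ℝ) :=
      inferInstanceAs (FirstCountableTopology (Fin a → Fin p → Fin p → ℝ))
    rw [nhds_subtype_eq_comap]
    infer_instance
  have hcdf := fun x => (hB.tendsto_measureReal_mancats_le hD' (limScoreCov_posSemidef hD hS) hSdiag
    hT hTT hM hF hFq hatom x).1
  have hunif := eventually_forall_abs_sub_lt_of_monotone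
    (G := fun (τ : ℕ × {Vs : Fin a → Matrix (Fin p) (Fin p) ℝ // ∀ i, (Vs i).PosSemidef}) x =>
      (Measure.pi fun s : Subj (n τ.1) => multivariateGaussian 0 (τ.2.1 s.1)).real
        {y | mancats z (n τ.1) T (fun s k => y s k) ≤ x})
    (fun τ x y hxy => measureReal_mono fun ω hω => le_trans hω hxy)
    (fun τ x => measureReal_nonneg) (fun τ x => measureReal_le_one) hF hFmono hbot htop hcdf hδ
  -- outside the event that the estimators are positive semidefinite, any value will do
  let τ : (Σ _ : ℕ, Ω) → ℕ × {Vs : Fin a → Matrix (Fin p) (Fin p) ℝ // ∀ i, (Vs i).PosSemidef} :=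
    fun s => (s.1, if h : ∀ i, (covEst z (n s.1) (e s.1 s.2) i).PosSemidef then ⟨_, h⟩ else ⟨S, hS⟩)
  have hpsd : ∀ᶠ s : Σ _ : ℕ, Ω in whp atTop (fun _ => P),
      ∀ i, (covEst z (n s.1) (e s.1 s.2) i).PosSemidef := by
    filter_upwards [tendsto_fst_whp.eventually hD.dof_pos] with s hs i
    exact covEst_posSemidef _ hs i
  have hτ : Tendsto τ (whp atTop fun _ => P) (atTop ×ˢ 𝓝 ⟨S, hS⟩) := by
    refine tendsto_fst_whp.prodMk (tendsto_subtype_rng.2 ?_)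
    have h1 : Tendsto (fun s : Σ _ : ℕ, Ω => covEst z (n s.1) (e s.1 s.2)) (whp atTop fun _ => P)
        (𝓝 S) :=
      tendsto_pi_nhds.2 fun i => tendsto_pi_nhds.2 fun k => tendsto_pi_nhds.2 fun k' =>
        hE.tendsto_covEst hD i k k'
    refine h1.congr' ?_
    filter_upwards [hpsd] with s hs
    rw [dif_pos hs]
  filter_upwards [hτ.eventually hunif, hpsd] with s hs h x
  have h2 := hs x
  simp only [τ, dif_pos h] at h2
  exact h2

end Mancova

theorem theorem4 {a c p r : ℕ}
    -- probability space carrying the errors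
    {Ω : Type*} [MeasurableSpace Ω] (P : Measure Ω) [IsProbabilityMeasure P]
    -- fixed covariates, errors, error covariances, group sizes along the asymptotics
    (z : Fin a → ℕ → Fin c → ℝ)
    (ε : Fin a → ℕ → Ω → Fin p → ℝ)
    (S : Fin a → Matrix (Fin p) (Fin p) ℝ)
    (n : ℕ → Fin a → ℕ)
    (κ : Fin a → ℝ) (m : Fin a → Fin c → ℝ) (Ξ : Fin a → Matrix (Fin c) (Fin c) ℝ)
    -- contrast matrix defining the hypothesis
    (H : Matrix (Fin r) (Fin a × Fin p) ℝ) (hH : H *ᵥ (fun _ => 1) = 0)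
    -- the total sample size tends to infinity
    (hN : Tendsto (fun t => Mancova.total (n t)) atTop atTop)
    -- (M1) independent centred errors, groupwise covariance, uniformly bounded fourth moments
    (hmeas : ∀ i j, Measurable (ε i j))
    (hindep : iIndepFun (fun (ij : Fin a × ℕ) => ε ij.1 ij.2) P)
    (hmean : ∀ i j k, ∫ ω, ε i j ω k ∂P = 0)
    (hcov : ∀ i j k l, cov[fun ω => ε i j ω k, fun ω => ε i j ω l; P] = S i k l)
    (C₁ : ℝ)
    (hfourth : ∀ i j k, Integrable (fun ω => ε i j ω k ^ 4) P ∧ ∫ ω, ε i j ω k ^ 4 ∂P ≤ C₁)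
    -- (M2)* possibly singular covariances with positive variances
    (hS : ∀ i, (S i).PosSemidef) (hSdiag : ∀ i k, 0 < S i k k)
    -- (M3) no group is asymptotically negligible
    (hκ : ∀ i, 0 < κ i)
    (hsize : ∀ i, Tendsto (fun t => (Mancova.total (n t) : ℝ) / n t i) atTop (𝓝 (κ i)))
    -- (M4) full column rank of the design, also in the limit
    (hrank : ∀ᶠ t in atTop, LinearIndependent ℝ (Mancova.design z (n t)).col)
    (hlimrank : (Mancova.limGram κ m Ξ).det ≠ 0)
    -- (M5), (M6) convergence of the first and second moments of the covariates
    (hfirst : ∀ i w, Tendsto (fun s : ℕ => (s : ℝ)⁻¹ * ∑ j ∈ Finset.range s, z i j w) atTop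
      (𝓝 (m i w)))
    (hsecond : ∀ i w v, Tendsto
      (fun s : ℕ => (s : ℝ)⁻¹ * ∑ j ∈ Finset.range s, z i j w * z i j v) atTop (𝓝 (Ξ i w v)))
    -- the limiting null distribution is not the point mass at zero
    (hnondeg : Mancova.hypProj H * Mancova.limCovMeans κ m Ξ S * Mancova.hypProj H ≠ 0) :
    -- uniform convergence in probability of the bootstrap distribution function
    (∀ B B₀ : Matrix (Fin a ⊕ Fin c) (Fin p) ℝ,
      Mancova.hypProj H *ᵥ Mancova.adjMeans B₀ = 0 →
      TendstoInMeasure P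
        (fun t ω => ⨆ x : ℝ,
          |Mancova.bootCDF z (n t) (Mancova.hypProj H)
              (Mancova.modelData z (n t) B fun i j => ε i j ω) x -
            P.real {ω' | Mancova.mancats z (n t) (Mancova.hypProj H)
              (Mancova.modelData z (n t) B₀ fun i j => ε i j ω') ≤ x}|)
        atTop (fun _ => 0)) ∧
    -- the bootstrap test has asymptotic level `α`
    (∀ B₀ : Matrix (Fin a ⊕ Fin c) (Fin p) ℝ,
      Mancova.hypProj H *ᵥ Mancova.adjMeans B₀ = 0 →
      ∀ α : ℝ, 0 < α → α < 1 →
      Tendsto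
        (fun t => P.real {ω |
          Mancova.bootQuantile z (n t) (Mancova.hypProj H)
              (Mancova.modelData z (n t) B₀ fun i j => ε i j ω) (1 - α) <
            Mancova.mancats z (n t) (Mancova.hypProj H)
              (Mancova.modelData z (n t) B₀ fun i j => ε i j ω)})
        atTop (𝓝 α)) := by
  set T := Mancova.hypProj H with hTdef
  have hT : Tᵀ = T := Mancova.hypProj_transpose H
  have hTT : T * T = T := Mancova.hypProj_mul_self H
  have hD : Mancova.DesignLimit atTop z n κ m Ξ :=
    ⟨hN, hκ, hsize, hlimrank, hfirst, hsecond⟩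
  have hmeask : ∀ i j k, Measurable fun ω => ε i j ω k := fun i j k =>
    (measurable_pi_apply k).comp (hmeas i j)
  have hL2 : ∀ i j k, MemLp (fun ω => ε i j ω k) 2 P := fun i j k =>
    Mancova.memLp_two_of_pow_four (hmeask i j k) (hfourth i j k).1
  have hE : Mancova.ErrorArray atTop n (fun _ => P)
      (fun t ω (s : Mancova.Subj (n t)) => ε s.1 s.2 ω) (fun _ => S) S C₁ :=
    { meas := fun t s => hmeas s.1 s.2
      indep := fun t => hindep.precomp (g := fun s : Mancova.Subj (n t) => (s.1, (s.2 : ℕ)))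
        (by
          rintro ⟨i, j⟩ ⟨i', j'⟩ h
          simp only [Prod.mk.injEq] at h
          obtain ⟨rfl, h⟩ := h
          rw [Fin.ext h])
      mean := fun t s k => hmean s.1 s.2 k
      second := fun t s k k' => by
        rw [← hcov s.1 s.2 k k', covariance_eq_sub (hL2 _ _ k) (hL2 _ _ k'), hmean, hmean, zero_mul,
          sub_zero]
        rfl
      fourth_integrable := fun t s k => (hfourth s.1 s.2 k).1
      fourth_le := Eventually.of_forall fun t s k => (hfourth s.1 s.2 k).2
      tendsto_cov := tendsto_const_nhds }
  have hpsd := Mancova.limScoreCov_posSemidef hD hS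
  -- the limiting distribution function
  set M := Mancova.formMatrix T (Mancova.limGram κ m Ξ)⁻¹
    (diagonal fun ik => κ ik.1 * S ik.1 ik.2 ik.2) with hM
  have hatom : ∀ x, multivariateGaussian 0 (Mancova.limScoreCov κ m Ξ S)
      {v | v.ofLp ⬝ᵥ (M *ᵥ v.ofLp) = x} = 0 :=
    Mancova.limit_quadratic_eq_null hD hS hSdiag hT hTT hnondeg
  have hq : Continuous fun v : EuclideanSpace ℝ ((Fin a ⊕ Fin c) × Fin p) =>
      v.ofLp ⬝ᵥ (M *ᵥ v.ofLp) := by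
    simp only [dotProduct, mulVec]
    fun_prop
  obtain ⟨F, hFq, hF, hFmono, hbot, htop⟩ : ∃ F : ℝ → ℝ,
      (∀ x, F x = (multivariateGaussian 0 (Mancova.limScoreCov κ m Ξ S)).real
        {v | v.ofLp ⬝ᵥ (M *ᵥ v.ofLp) ≤ x}) ∧
      Continuous F ∧ Monotone F ∧ Tendsto F atBot (𝓝 0) ∧ Tendsto F atTop (𝓝 1) :=
    ⟨_, fun _ => rfl, Mancova.continuous_measureReal_le hq.measurable hatom⟩
  have hcore := hE.tendsto_measureReal_mancats_le hD hpsd hSdiag hT hTT hM hF hFq hatom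
  clear_value M T
  have hboot : ∀ B : Matrix (Fin a ⊕ Fin c) (Fin p) ℝ, ∀ δ > 0,
      ∀ᶠ s : Σ _ : ℕ, Ω in Mancova.whp atTop (fun _ => P),
        ∀ x, |Mancova.bootCDF z (n s.1) T
          (Mancova.modelData z (n s.1) B fun i j => ε i j s.2) x - F x| < δ := by
    intro B δ hδ
    filter_upwards [Mancova.eventually_whp_bootCDF hD hS hSdiag hT hTT hM hF hFmono hbot htop
      hFq hatom hE hδ, Mancova.tendsto_fst_whp.eventually hD.isUnit_det] with s hs hdet
    rw [Mancova.bootCDF_modelData hdet]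
    exact hs
  have hcongr : ∀ B₀ : Matrix (Fin a ⊕ Fin c) (Fin p) ℝ, T *ᵥ Mancova.adjMeans B₀ = 0 →
      ∀ᶠ t in atTop, ∀ ω, Mancova.mancats z (n t) T
        (Mancova.modelData z (n t) B₀ fun i j => ε i j ω) =
        Mancova.mancats z (n t) T fun s => ε s.1 s.2 ω := by
    intro B₀ hB₀
    filter_upwards [hD.isUnit_det] with t hdet ω
    exact Mancova.mancats_modelData hdet hB₀ fun i j => ε i j ω
  refine ⟨fun B B₀ hB₀ => ?_, fun B₀ hB₀ α hα0 hα1 => ?_⟩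
  · have hpolya : ∀ δ > 0, ∀ᶠ t in atTop, ∀ x, |P.real {ω' | Mancova.mancats z (n t) T
        (Mancova.modelData z (n t) B₀ fun i j => ε i j ω') ≤ x} - F x| < δ := by
      intro δ hδ
      filter_upwards [Mancova.eventually_forall_abs_sub_lt_of_monotone
        (G := fun t x => P.real {ω | Mancova.mancats z (n t) T (fun s => ε s.1 s.2 ω) ≤ x})
        (fun t x y hxy => measureReal_mono fun ω hω => le_trans hω hxy)
        (fun t x => measureReal_nonneg) (fun t x => measureReal_le_one) hF hFmono hbot htop
        (fun x => (hcore x).1) hδ, hcongr B₀ hB₀] with t ht h x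
      simp only [h]
      exact ht x
    rw [tendstoInMeasure_iff_norm]
    intro η hη
    have hev : ∀ᶠ s : Σ _ : ℕ, Ω in Mancova.whp atTop (fun _ => P),
        (⨆ x : ℝ, |Mancova.bootCDF z (n s.1) T
          (Mancova.modelData z (n s.1) B fun i j => ε i j s.2) x -
          P.real {ω' | Mancova.mancats z (n s.1) T
            (Mancova.modelData z (n s.1) B₀ fun i j => ε i j ω') ≤ x}|) < η := by
      filter_upwards [hboot B (η / 4) (by positivity),
        Mancova.tendsto_fst_whp.eventually (hpolya (η / 4) (by positivity))] with s h1 h2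
      refine (ciSup_le fun x => ?_).trans_lt (half_lt_self hη)
      have h3 := abs_lt.1 (h1 x)
      have h4 := abs_lt.1 (h2 x)
      rw [abs_le]
      constructor <;> linarith
    refine tendsto_of_tendsto_of_tendsto_of_le_of_le tendsto_const_nhds
      (Mancova.eventually_whp.1 hev) (fun _ => zero_le) fun t => measure_mono fun ω hω => ?_
    rw [Set.mem_ofPred_eq, sub_zero,
      Real.norm_of_nonneg (Real.iSup_nonneg fun x => abs_nonneg _)] at hω
    exact not_lt.2 hω
  · rw [Metric.tendsto_nhds]
    intro η hη
    -- `δ` keeps the shifted levels `1 - α ± 2δ` inside `(0, 1)` and the total error below `η`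
    obtain ⟨δ, hδ, hδ1, hδ2, hδ3⟩ : ∃ δ > 0, 2 * δ < α ∧ 2 * δ < 1 - α ∧ 4 * δ < η := by
      refine ⟨min (min (α / 4) ((1 - α) / 4)) (η / 8), ?_, ?_, ?_, ?_⟩
      · have : 0 < 1 - α := by linarith
        positivity
      · have := (min_le_left _ (η / 8)).trans (min_le_left (α / 4) ((1 - α) / 4))
        linarith
      · have := (min_le_left _ (η / 8)).trans (min_le_right (α / 4) ((1 - α) / 4))
        linarith
      · have := min_le_right (min (α / 4) ((1 - α) / 4)) (η / 8)
        linarith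
    have hsurj : ∀ y, 0 < y → y < 1 → ∃ x, F x = y := fun y h0 h1 =>
      mem_range_of_exists_le_of_exists_ge hF
        ((hbot.eventually_lt_const h0).exists.imp fun _ h => h.le)
        ((htop.eventually_const_lt h1).exists.imp fun _ h => h.le)
    obtain ⟨x₀, hx₀⟩ := hsurj (1 - α - 2 * δ) (by linarith) (by linarith)
    obtain ⟨x₁, hx₁⟩ := hsurj (1 - α + 2 * δ) (by linarith) (by linarith)
    have hquant : ∀ᶠ s : Σ _ : ℕ, Ω in Mancova.whp atTop (fun _ => P),
        Mancova.bootQuantile z (n s.1) T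
          (Mancova.modelData z (n s.1) B₀ fun i j => ε i j s.2) (1 - α) ∈ Set.Icc x₀ x₁ := by
      filter_upwards [hboot B₀ δ hδ] with s hs
      exact Mancova.sInf_quantile_mem_Icc hFmono hδ hs hx₀ hx₁
    filter_upwards [Mancova.eventually_measureReal_lt hquant hδ, hcongr B₀ hB₀,
      Metric.tendsto_nhds.1 (hcore x₀).2 δ hδ, Metric.tendsto_nhds.1 (hcore x₁).2 δ hδ]
      with t hbad hc h0 h1
    rw [hx₀, Real.dist_eq, abs_lt] at h0
    rw [hx₁, Real.dist_eq, abs_lt] at h1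
    simp only [hc]
    have hup := (measureReal_mono (μ := P) (s₁ := {ω | Mancova.bootQuantile z (n t) T
        (Mancova.modelData z (n t) B₀ fun i j => ε i j ω) (1 - α) <
          Mancova.mancats z (n t) T fun s => ε s.1 s.2 ω})
      (s₂ := {ω | x₀ < Mancova.mancats z (n t) T fun s => ε s.1 s.2 ω} ∪
        {ω | ¬ Mancova.bootQuantile z (n t) T
          (Mancova.modelData z (n t) B₀ fun i j => ε i j ω) (1 - α) ∈ Set.Icc x₀ x₁})
      fun ω hω => by
        by_cases h : Mancova.bootQuantile z (n t) T
          (Mancova.modelData z (n t) B₀ fun i j => ε i j ω) (1 - α) ∈ Set.Icc x₀ x₁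
        · exact Or.inl (lt_of_le_of_lt h.1 hω)
        · exact Or.inr h).trans (measureReal_union_le _ _)
    have hlow := (measureReal_mono (μ := P)
      (s₁ := {ω | x₁ < Mancova.mancats z (n t) T fun s => ε s.1 s.2 ω})
      (s₂ := {ω | Mancova.bootQuantile z (n t) T
        (Mancova.modelData z (n t) B₀ fun i j => ε i j ω) (1 - α) <
          Mancova.mancats z (n t) T fun s => ε s.1 s.2 ω} ∪
        {ω | ¬ Mancova.bootQuantile z (n t) T
          (Mancova.modelData z (n t) B₀ fun i j => ε i j ω) (1 - α) ∈ Set.Icc x₀ x₁})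
      fun ω hω => by
        by_cases h : Mancova.bootQuantile z (n t) T
          (Mancova.modelData z (n t) B₀ fun i j => ε i j ω) (1 - α) ∈ Set.Icc x₀ x₁
        · exact Or.inl (lt_of_le_of_lt h.2 hω)
        · exact Or.inr h).trans (measureReal_union_le _ _)
    rw [Real.dist_eq, abs_lt]
    constructor <;> linarith
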